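/- **Setting.** Let $f:\mathbb R^n\to\mathbb R$ be continuously differentiable with $f\ge f_{\min}$ on $\mathbb R^n$ for some $f_{\min}\in\mathbb R$. Fix $\gamma>1$, $\eta_1\in(0,1)$, $\eta_2>0$, $j_{\max}\in\mathbb N$, $\delta_0>0$, $x_0\in\mathbb R^n$, and put $\delta_{\max}=\gamma^{j_{\max}}\delta_0$. On a probability space, the stochastic trust-region algorithm STARS generates for $k=0,1,2,\dots$ random matrices $Q_k\in\mathbb R^{n\times p}$, random quadratic models $\hat m_k(s)=c_k+\hat g_k^\top s+\tfrac12 s^\top\hat H_k s$ on $\mathbb R^p$ with $\hat H_k$ symmetric, random trial steps $s_k\in\mathbb R^p$ with $\|s_k\|\le\delta_k$, and random estimates $f_k^0,f_k^s\in\mathbb R$. With $\rho_k=\frac{f_k^0-f_k^s}{\hat m_k(0)-\hat m_k(s_k)}$, iteration $k$ is successful if $\rho_k\ge\eta_1$ and $\|\hat g_k\|\ge\eta_2\delta_k$; then $x_{k+1}=x_k+Q_ks_k$ and $\delta_{k+1}=\min\{\gamma\delta_k,\delta_{\max}\}$. Otherwise $x_{k+1}=x_k$ and $\delta_{k+1}=\gamma^{-1}\delta_k$.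 Let $\mathcal F_{k-1}$ be the $\sigma$-algebra generated by $f_\ell^0,f_\ell^s,\hat m_\ell,Q_\ell$ for $0\le\ell\le k-1$ (trivial for $k=0$), and let $\mathcal F^Q_{k-1}=\mathcal F_{k-1}\vee\sigma(Q_k)$ and $\mathcal F^{\hat m\cdot Q}_{k-1}=\mathcal F^Q_{k-1}\vee\sigma(\hat m_k)$. The step $s_k$, computed before the estimates of iteration $k$, is $\mathcal F^{\hat m\cdot Q}_{k-1}$-measurable. **Assumptions.** Vector norms are Euclidean; matrix norms are any norms consistent with the Euclidean norm, $\|Av\|\le\|A\|\,\|v\|$. For every realization: * $f$ and $\nabla f$ are Lipschitz on $\bigcup_k\{x_k+Q_ks:\|s\|\le\delta_{\max}\}$, with constants $L_f$ and $L_g$ that do not depend on the realization; * for all $k$, $\|Q_k\|\le Q_{\max}$ and $\|\hat H_k\|\le\kappa_h$, where $Q_{\max}>0$ and $\kappa_h\ge1$ are constants; * for all $k$, with a constant $\kappa_{fcd}\in(0,1]$, $$\hat m_k(0)-\hat m_k(s_k)\ge\frac{\kappa_{fcd}}2\|\hat g_k\|\min\Big\{\delta_k,\frac{\|\hat g_k\|}{\max(\|\hat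 H_k\|,1)}\Big\}.$$ Let $\kappa_{ef},\kappa_{eg}>0$, $0<\varepsilon_f<\min\big\{\kappa_{ef},\tfrac14\eta_1\eta_2\kappa_{fcd}\min\{\eta_2/\kappa_h,1\}\big\}$ and $\beta_f,\beta_m\in(0,1)$. Assume that for all $k$, almost surely, $\mathbb P(I_k\mid\mathcal F^Q_{k-1})\ge\beta_m$ and $\mathbb P(J_k\mid\mathcal F^{\hat m\cdot Q}_{k-1})\ge\beta_f$, where $I_k$ is the event that for all $s\in\mathbb R^p$ with $\|s\|\le\delta_k$ $$|f(x_k+Q_ks)-\hat m_k(s)|\le\kappa_{ef}\delta_k^2\quad\text{and}\quad\|Q_k^\top\nabla f(x_k+Q_ks)-\nabla\hat m_k(s)\|\le\kappa_{eg}\delta_k,$$ and $J_k$ is the event that $|f_k^0-f(x_k)|\le\varepsilon_f\delta_k^2$ and $|f_k^s-f(x_k+Q_ks_k)|\le\varepsilon_f\delta_k^2$. Put $$C_1=\frac{\kappa_{fcd}}4\max\Big\{\frac{\kappa_h}{\kappa_h+\kappa_{eg}},\frac{8\kappa_{ef}}{8\kappa_{ef}+\kappa_{fcd}\kappa_{eg}}\Big\},\qquad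 C_2=\tfrac12\eta_1\eta_2\kappa_{fcd}\min\Big\{\frac{\eta_2}{\kappa_h},1\Big\}-2\varepsilon_f,\qquad C_3=1+\frac{3L_g}{2\zeta}Q_{\max}^2,$$ and let $\zeta>0$, $\nu\in(0,1)$ and $\beta_f,\beta_m$ satisfy $$\zeta\ge\kappa_{eg}+\max\Big\{\eta_2,\kappa_h,\frac{8\kappa_{ef}}{\kappa_{fcd}(1-\eta_1)}\Big\},\qquad\frac\nu{1-\nu}\ge\frac{8\gamma^2}{\min\{C_2,\zeta C_1\}},$$ $$\frac{\beta_f\beta_m-\frac12}{(1-\beta_f)+(1-\beta_m)}\ge\frac{C_3}{C_1},\qquad\frac{\beta_f}{1-\beta_f}\ge\frac{2\nu\zeta\gamma^2C_3}{(1-\nu)(\gamma^2-1)}+2\gamma^2.$$ **Theorem.** Let $\varrho=\tfrac12\beta_f(1-\nu)\big(1-\tfrac1{\gamma^2}\big)$ and $\phi_k=\nu(f(x_k)-f_{\min})+(1-\nu)\delta_k^2$. Then $\varrho>0$, every $\phi_k$ is integrable, and $$\mathbb E[\phi_{k+1}-\phi_k\mid\mathcal F^Q_{k-1}]\le-\varrho\,\delta_k^2\quad\text{almost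 surely, for all }k\in\mathbb N.$$ Consequently $\sum_{k=0}^\infty\delta_k^2<\infty$ almost surely, and $\delta_k\to0$ almost surely. -/

import Mathlib

open MeasureTheory ProbabilityTheory Filter Topology
open scoped NNReal

namespace STARS

/-- The Euclidean space `ℝᵈ`. -/
abbrev E (d : ℕ) : Type := EuclideanSpace ℝ (Fin d)

/-- The matrix-vector product `A v`, with values in a Euclidean space. -/
noncomputable def act {a b : ℕ} (A : Matrix (Fin a) (Fin b) ℝ) (v : E b) : E a :=
  WithLp.toLp 2 (A.mulVec v.ofLp)

/-- A matrix (semi)norm that is consistent with the Euclidean norm: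
`‖A v‖₂ ≤ ‖A‖ ‖v‖₂` (for instance the spectral norm or the Frobenius norm). -/
def IsConsistentNorm {a b : ℕ} (N : Seminorm ℝ (Matrix (Fin a) (Fin b) ℝ)) : Prop :=
  ∀ (A : Matrix (Fin a) (Fin b) ℝ) (v : E b), ‖act A v‖ ≤ N A * ‖v‖

/-! ### Quadratic models on the subspace -/

/-- A quadratic model on `ℝᵖ`: constant term, gradient at the origin, symmetric Hessian. -/
structure QuadModel (p : ℕ) where
  const : ℝ
  grad : E p
  hess : Matrix (Fin p) (Fin p) ℝ
  hess_symm : hess.IsSymm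

/-- `m(s) = c + gᵀ s + ½ sᵀ H s`. -/
noncomputable def QuadModel.eval {p : ℕ} (m : QuadModel p) (s : E p) : ℝ :=
  m.const + inner ℝ m.grad s + (1 / 2) * inner ℝ s (act m.hess s)

/-- The σ-algebra on quadratic models generated by their coefficients. -/
instance {p : ℕ} : MeasurableSpace (QuadModel p) :=
  MeasurableSpace.comap QuadModel.const inferInstance ⊔
    MeasurableSpace.comap QuadModel.grad inferInstance ⊔
    ⨆ (i : Fin p) (j : Fin p), MeasurableSpace.comap (fun m : QuadModel p => m.hess i j) inferInstance

/-- The set `{x + Q s : ‖s‖ ≤ r}`. -/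
def subspaceBall {n p : ℕ} (x : E n) (r : ℝ) (Q : Matrix (Fin n) (Fin p) ℝ) : Set (E n) :=
  {y | ∃ s : E p, ‖s‖ ≤ r ∧ y = x + act Q s}

/-- `m` is a `(κ_ef, κ_eg; Q)`-fully linear model of `f` in `subspaceBall x δ Q`. -/
def IsFullyLinear {n p : ℕ} (f : E n → ℝ) (κef κeg : ℝ) (x : E n) (δ : ℝ)
    (Q : Matrix (Fin n) (Fin p) ℝ) (m : QuadModel p) : Prop :=
  ∀ s : E p, ‖s‖ ≤ δ →
    |f (x + act Q s) - m.eval s| ≤ κef * δ ^ 2 ∧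
    ‖act Q.transpose (gradient f (x + act Q s)) - gradient m.eval s‖ ≤ κeg * δ

/-- `f0` and `fs` are `ε`-accurate estimates of `f x` and `f (x + Q s)` for the radius `δ`. -/
def IsAccurate {n p : ℕ} (f : E n → ℝ) (ε : ℝ) (x : E n) (δ : ℝ)
    (Q : Matrix (Fin n) (Fin p) ℝ) (s : E p) (f0 fs : ℝ) : Prop :=
  |f0 - f x| ≤ ε * δ ^ 2 ∧ |fs - f (x + act Q s)| ≤ ε * δ ^ 2

/-- The fraction of Cauchy decrease condition for the step `s`, with matrix norm `N`. -/
def CauchyDecrease {p : ℕ} (N : Seminorm ℝ (Matrix (Fin p) (Fin p) ℝ)) (κfcd δ : ℝ)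
    (m : QuadModel p) (s : E p) : Prop :=
  κfcd / 2 * ‖m.grad‖ * min δ (‖m.grad‖ / max (N m.hess) 1) ≤ m.eval 0 - m.eval s

/-! ### The algorithm -/

/-- The user-chosen constants of the algorithm. -/
structure Params (n : ℕ) where
  γ : ℝ
  η₁ : ℝ
  η₂ : ℝ
  jmax : ℕ
  δ₀ : ℝ
  x₀ : E n
  one_lt_γ : 1 < γ
  η₁_pos : 0 < η₁
  η₁_lt_one : η₁ < 1
  η₂_pos : 0 < η₂
  δ₀_pos : 0 < δ₀

/-- The maximum trust-region radius. -/
noncomputable def Params.δmax {n : ℕ} (P : Params n) : ℝ := P.γ ^ P.jmax * P.δ₀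

/-- What is generated during an iteration, as random quantities: the subspace matrices `Q k`, the
models `m k`, the trial steps `s k` and the function estimates `f0 k`, `fs k`. -/
structure Run (Ω : Type*) (n p : ℕ) where
  Q : ℕ → Ω → Matrix (Fin n) (Fin p) ℝ
  m : ℕ → Ω → QuadModel p
  s : ℕ → Ω → E p
  f0 : ℕ → Ω → ℝ
  fs : ℕ → Ω → ℝ

/-- Success test: `ρ ≥ η₁` and `‖g‖ ≥ η₂ δ`, where
`ρ = (f0 - fs) / (m 0 - m s)` and `g` is the model gradient. -/
def Success {n p : ℕ} (P : Params n) (δ : ℝ) (m : QuadModel p) (s : E p) (f0 fs : ℝ) : Prop :=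
  P.η₁ ≤ (f0 - fs) / (m.eval 0 - m.eval s) ∧ P.η₂ * δ ≤ ‖m.grad‖

section Dynamics

variable {Ω : Type*} {n p : ℕ}

open Classical in
/-- The pair (iterate `x_k`, trust-region radius `δ_k`) produced by the update rule. -/
noncomputable def state (P : Params n) (R : Run Ω n p) : ℕ → Ω → E n × ℝ
  | 0, _ => (P.x₀, P.δ₀)
  | k + 1, ω =>
    if Success P (state P R k ω).2 (R.m k ω) (R.s k ω) (R.f0 k ω) (R.fs k ω) then
      ((state P R k ω).1 + act (R.Q k ω) (R.s k ω), min (P.γ * (state P R k ω).2) P.δmax)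
    else ((state P R k ω).1, P.γ⁻¹ * (state P R k ω).2)

/-- The iterate `x_k`. -/
noncomputable def iter (P : Params n) (R : Run Ω n p) (k : ℕ) (ω : Ω) : E n := (state P R k ω).1

/-- The trust-region radius `δ_k`. -/
noncomputable def radius (P : Params n) (R : Run Ω n p) (k : ℕ) (ω : Ω) : ℝ := (state P R k ω).2

/-- The region considered by the realization `ω` of the algorithm: the union over `k` of the sets
`{x_k + Q_k s : ‖s‖ ≤ δ_max}`. -/
def region (P : Params n) (R : Run Ω n p) (ω : Ω) : Set (E n) :=
  ⋃ k : ℕ, subspaceBall (iter P R k ω) P.δmax (R.Q k ω)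

/-- The σ-algebra generated by the entries of `Q_k`. -/
@[reducible] def sigmaQ (R : Run Ω n p) (k : ℕ) : MeasurableSpace Ω :=
  ⨆ (i : Fin n) (j : Fin p), MeasurableSpace.comap (fun ω => R.Q k ω i j) inferInstance

/-- The σ-algebra generated by the model `m_k`. -/
@[reducible] def sigmaM (R : Run Ω n p) (k : ℕ) : MeasurableSpace Ω :=
  MeasurableSpace.comap (R.m k) inferInstance

/-- `𝓕_{k-1}`, generated by the estimates, models and matrices of the iterations `0, …, k-1`
(trivial for `k = 0`, the starting point being deterministic). -/
@[reducible] def past (R : Run Ω n p) (k : ℕ) : MeasurableSpace Ω :=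
  ⨆ (l : ℕ) (_ : l < k),
    MeasurableSpace.comap (R.f0 l) inferInstance ⊔ MeasurableSpace.comap (R.fs l) inferInstance ⊔
      sigmaM R l ⊔ sigmaQ R l

/-- `𝓕^Q_{k-1}`, generated by `𝓕_{k-1}` and `Q_k`. -/
@[reducible] def pastQ (R : Run Ω n p) (k : ℕ) : MeasurableSpace Ω := past R k ⊔ sigmaQ R k

/-- `𝓕^{m·Q}_{k-1}`, generated by `𝓕^Q_{k-1}` and the model `m_k`. -/
@[reducible] def pastMQ (R : Run Ω n p) (k : ℕ) : MeasurableSpace Ω := pastQ R k ⊔ sigmaM R k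

/-- All generated quantities are random variables, and the trial step of iteration `k`, which is
computed once `Q_k` and the model `m_k` are available and before the estimates, is determined by the
past, `Q_k` and `m_k`. -/
structure Run.IsRandom [MeasurableSpace Ω] (R : Run Ω n p) : Prop where
  measurable_Q : ∀ k i j, Measurable (fun ω => R.Q k ω i j)
  measurable_m : ∀ k, Measurable (R.m k)
  measurable_f0 : ∀ k, Measurable (R.f0 k)
  measurable_fs : ∀ k, Measurable (R.fs k)
  measurable_s : ∀ k, Measurable[pastMQ R k] (R.s k)

/-- The event that the `k`-th model is fully linear in `{x_k + Q_k s : ‖s‖ ≤ δ_k}`. -/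
def goodModel (P : Params n) (R : Run Ω n p) (f : E n → ℝ) (κef κeg : ℝ) (k : ℕ) : Set Ω :=
  {ω | IsFullyLinear f κef κeg (iter P R k ω) (radius P R k ω) (R.Q k ω) (R.m k ω)}

/-- The event that the estimates of iteration `k` are `ε`-accurate. -/
def goodEstimates (P : Params n) (R : Run Ω n p) (f : E n → ℝ) (ε : ℝ) (k : ℕ) : Set Ω :=
  {ω | IsAccurate f ε (iter P R k ω) (radius P R k ω) (R.Q k ω) (R.s k ω) (R.f0 k ω) (R.fs k ω)}

/-- The models are `β`-probabilistically `(κ_ef, κ_eg; Q_k)`-fully linear: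
`ℙ(I_k | 𝓕^Q_{k-1}) ≥ β` almost surely, for all `k`. -/
def ProbFullyLinear [MeasurableSpace Ω] (μ : Measure Ω) (P : Params n) (R : Run Ω n p)
    (f : E n → ℝ) (κef κeg β : ℝ) : Prop :=
  ∀ k, ∀ᵐ ω ∂μ, β ≤ (μ⟦goodModel P R f κef κeg k | pastQ R k⟧) ω

/-- The estimates are `β`-probabilistically `ε`-accurate:
`ℙ(J_k | 𝓕^{m·Q}_{k-1}) ≥ β` almost surely, for all `k`. -/
def ProbAccurate [MeasurableSpace Ω] (μ : Measure Ω) (P : Params n) (R : Run Ω n p)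
    (f : E n → ℝ) (ε β : ℝ) : Prop :=
  ∀ k, ∀ᵐ ω ∂μ, β ≤ (μ⟦goodEstimates P R f ε k | pastMQ R k⟧) ω

/-- `φ_k = ν (f(x_k) - f_min) + (1 - ν) δ_k²`. -/
noncomputable def merit (P : Params n) (R : Run Ω n p) (f : E n → ℝ) (fmin ν : ℝ) (k : ℕ)
    (ω : Ω) : ℝ :=
  ν * (f (iter P R k ω) - fmin) + (1 - ν) * radius P R k ω ^ 2

end Dynamics

/-! ### Constants -/

/-- `C₁ = (κ_fcd/4) max{κ_h/(κ_h+κ_eg), 8κ_ef/(8κ_ef+κ_fcd κ_eg)}`. -/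
noncomputable def C₁ (κfcd κh κef κeg : ℝ) : ℝ :=
  κfcd / 4 * max (κh / (κh + κeg)) (8 * κef / (8 * κef + κfcd * κeg))

/-- `C₂ = ½ η₁ η₂ κ_fcd min{η₂/κ_h, 1} - 2 ε_f`. -/
noncomputable def C₂ (η₁ η₂ κfcd κh εf : ℝ) : ℝ :=
  1 / 2 * η₁ * η₂ * κfcd * min (η₂ / κh) 1 - 2 * εf

/-- `C₃(ζ) = 1 + 3 L_g Q_max² / (2 ζ)`. -/
noncomputable def C₃ (Lg Qmax ζ : ℝ) : ℝ := 1 + 3 * Lg / (2 * ζ) * Qmax ^ 2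

end STARS

/-! The argument bounds the change of the merit function along each path by indicators of accuracy
events, then conditions. Write h for the norm of `Q_kᵀ ∇f(x_k)`, δ for the radius, b =
(1-ν)(1-1/γ²), and let T be the event ζδ ≤ h, which is known once `Q_k` is drawn.

An unsuccessful iteration changes the merit by exactly -bδ². A successful one lets the radius term
grow by at most (1-ν)(γ²-1)δ², and this must be paid for by a decrease of f. Accurate estimates
guarantee a decrease C₂δ² (`IsAccurate.decrease`). A fully linear model on T guarantees C₁hδ ≥ ζC₁δ²
(`IsFullyLinear.decrease`), whatever the estimates are. The condition on ν makes either one outweigh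
the growth, so the merit still drops by at least bδ². If model and estimates are both good on T,
success is forced (`IsFullyLinear.success`) and the larger decrease C₁hδ is certain. Harm arises
only when both are bad on T, or the estimates are bad off T; the gradient Lipschitz bound then
limits the increase of f to C₃hδ or C₃ζδ². All this is `merit_succ_sub_le`.

Conditioning replaces the indicators by probabilities: at least β_fβ_m for both good, at most
(1-β_f)(1-β_m) for both bad, at most 1-β_f for bad estimates (`condProb_bounds`). The conditions on
β_f and β_m then give -ϱδ² on T and off T (`expected_bound_of_small_radius`,
`expected_bound_of_large_radius`). Since the merit is nonnegative, telescoping expectations bounds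
the sum of E[δ_k²], and Tonelli gives almost sure summability. -/

namespace STARS

/-! ### Deterministic estimates for a single trial step -/

section Deterministic

variable {n p : ℕ}

/-- The matrix-vector product as a continuous linear map. -/
noncomputable def actCLM {a b : ℕ} (A : Matrix (Fin a) (Fin b) ℝ) : E b →L[ℝ] E a :=
  LinearMap.toContinuousLinearMap
    { toFun := act A
      map_add' := fun u v => by ext i; simp [act, Matrix.mulVec_add]
      map_smul' := fun c v => by ext i; simp [act, Matrix.mulVec_smul] }

@[simp] lemma actCLM_apply {a b : ℕ} (A : Matrix (Fin a) (Fin b) ℝ) (v : E b) :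
    actCLM A v = act A v := rfl

lemma act_zero {a b : ℕ} (A : Matrix (Fin a) (Fin b) ℝ) : act A 0 = 0 := (actCLM A).map_zero

lemma act_smul {a b : ℕ} (A : Matrix (Fin a) (Fin b) ℝ) (c : ℝ) (v : E b) :
    act A (c • v) = c • act A v := (actCLM A).map_smul c v

lemma continuous_act {a b : ℕ} (A : Matrix (Fin a) (Fin b) ℝ) : Continuous (act A) :=
  (actCLM A).continuous

lemma act_apply {a b : ℕ} (A : Matrix (Fin a) (Fin b) ℝ) (v : E b) (i : Fin a) :
    act A v i = ∑ j, A i j * v j := rfl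

lemma inner_act_transpose {a b : ℕ} (A : Matrix (Fin a) (Fin b) ℝ) (u : E a) (v : E b) :
    inner ℝ (act A.transpose u) v = inner ℝ u (act A v) := by
  simp only [PiLp.inner_apply, act_apply, Matrix.transpose_apply, RCLike.inner_apply, conj_trivial,
    Finset.mul_sum, Finset.sum_mul]
  rw [Finset.sum_comm]
  exact Finset.sum_congr rfl fun _ _ => Finset.sum_congr rfl fun _ _ => by ring

lemma norm_act_le {a b : ℕ} {N : Seminorm ℝ (Matrix (Fin a) (Fin b) ℝ)} (hN : IsConsistentNorm N)
    {A : Matrix (Fin a) (Fin b) ℝ} {v : E b} {c r : ℝ} (hA : N A ≤ c) (hv : ‖v‖ ≤ r) :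
    ‖act A v‖ ≤ c * r :=
  (hN A v).trans (mul_le_mul hA hv (norm_nonneg _) ((apply_nonneg N A).trans hA))

/-- Consistency is assumed for the matrix itself, not its transpose. Duality transfers it: with w
the transpose applied to u, ‖w‖² = ⟨u, A w⟩ ≤ ‖u‖ N(A) ‖w‖. -/
lemma norm_act_transpose_le {a b : ℕ} {N : Seminorm ℝ (Matrix (Fin a) (Fin b) ℝ)}
    (hN : IsConsistentNorm N) (A : Matrix (Fin a) (Fin b) ℝ) (u : E a) :
    ‖act A.transpose u‖ ≤ N A * ‖u‖ := by
  set w := act A.transpose u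
  have h : ‖w‖ * ‖w‖ ≤ (N A * ‖u‖) * ‖w‖ := by
    calc ‖w‖ * ‖w‖ = inner ℝ w w := (real_inner_self_eq_norm_mul_norm w).symm
      _ = inner ℝ u (act A w) := inner_act_transpose A u w
      _ ≤ ‖u‖ * ‖act A w‖ := real_inner_le_norm _ _
      _ ≤ ‖u‖ * (N A * ‖w‖) := mul_le_mul_of_nonneg_left (hN A w) (norm_nonneg _)
      _ = _ := by ring
  rcases (norm_nonneg w).eq_or_lt with h0 | h0
  · rw [← h0]; exact mul_nonneg (apply_nonneg N A) (norm_nonneg _)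
  · exact le_of_mul_le_mul_right h h0

/-- Symmetry of the Hessian merges the two terms of the product rule, which cancels the factor 1/2.
-/
lemma QuadModel.hasGradientAt (m : QuadModel p) (s : E p) :
    HasGradientAt m.eval (m.grad + act m.hess s) s := by
  have h1 : HasFDerivAt (fun s : E p => inner ℝ m.grad s) (innerSL ℝ m.grad) s :=
    (innerSL ℝ m.grad).hasFDerivAt
  have h2 := (hasFDerivAt_id s).inner ℝ (actCLM m.hess).hasFDerivAt
  have h3 := ((hasFDerivAt_const m.const s).add h1).add (h2.const_mul (1 / 2 : ℝ))
  rw [hasGradientAt_iff_hasFDerivAt]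
  refine h3.congr_fderiv ?_
  ext v
  have h4 : inner ℝ s (act m.hess v) = inner ℝ (act m.hess s) v := by
    rw [← inner_act_transpose, m.hess_symm.eq]
  have h5 : inner ℝ v (act m.hess s) = inner ℝ (act m.hess s) v := real_inner_comm _ _
  simp [fderivInnerCLM_apply, h4, h5]
  ring

lemma QuadModel.gradient_eval (m : QuadModel p) (s : E p) :
    gradient m.eval s = m.grad + act m.hess s := (m.hasGradientAt s).gradient

lemma QuadModel.continuous_eval (m : QuadModel p) : Continuous m.eval :=
  continuous_iff_continuousAt.2 fun s => (m.hasGradientAt s).continuousAt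

lemma _root_.ContDiff.continuous_gradient {F : Type*} [NormedAddCommGroup F]
    [InnerProductSpace ℝ F] [CompleteSpace F] {f : F → ℝ} (hf : ContDiff ℝ 1 f) :
    Continuous (gradient f) :=
  (InnerProductSpace.toDual ℝ F).symm.continuous.comp (hf.continuous_fderiv one_ne_zero)

/-- A quadratic upper bound for `f` along a step in the subspace. -/
lemma apply_add_act_sub_le {f : E n → ℝ} (hf : ContDiff ℝ 1 f) {S : Set (E n)} {L : ℝ≥0}
    (hL : LipschitzOnWith L (gradient f) S) {x : E n} {Q : Matrix (Fin n) (Fin p) ℝ} {s : E p}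
    {N : Seminorm ℝ (Matrix (Fin n) (Fin p) ℝ)} (hN : IsConsistentNorm N) {q δ r : ℝ}
    (hq : N Q ≤ q) (hs : ‖s‖ ≤ δ) (hr : δ ≤ r) (hS : subspaceBall x r Q ⊆ S) :
    f (x + act Q s) - f x ≤ ‖act Q.transpose (gradient f x)‖ * δ + L * q ^ 2 * δ ^ 2 := by
  have hdiff := hf.differentiable one_ne_zero
  -- The mean value theorem, instead of the integral remainder, loses a factor 1/2 in the curvature
  -- term; the coefficient 3/2 in `C₃` leaves room for this.
  obtain ⟨z, hz, hzeq⟩ := domain_mvt (f := f) (s := Set.univ) (x := x) (y := x + act Q s)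
    (fun y _ => (hdiff y).hasGradientAt.hasFDerivAt.hasFDerivWithinAt) convex_univ trivial trivial
  rw [segment_eq_image'] at hz
  obtain ⟨t, ht, rfl⟩ := hz
  have hδ : 0 ≤ δ := (norm_nonneg _).trans hs
  have hq0 : 0 ≤ q := (apply_nonneg N Q).trans hq
  simp only [add_sub_cancel_left] at hzeq
  rw [hzeq, InnerProductSpace.toDual_apply_apply]
  set d := act Q s with hd
  have hd_le : ‖d‖ ≤ q * δ := norm_act_le hN hq hs
  have hx : x ∈ S := hS ⟨0, by simpa using hδ.trans hr, by simp [act_zero]⟩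
  have hxt : x + t • d ∈ S := by
    refine hS ⟨t • s, ?_, by rw [act_smul]⟩
    rw [norm_smul, Real.norm_of_nonneg ht.1]
    exact (mul_le_of_le_one_left (norm_nonneg _) ht.2).trans (hs.trans hr)
  have h1 : ‖gradient f (x + t • d) - gradient f x‖ ≤ L * (q * δ) := by
    refine (hL.norm_sub_le hxt hx).trans (mul_le_mul_of_nonneg_left ?_ L.2)
    rw [add_sub_cancel_left, norm_smul, Real.norm_of_nonneg ht.1]
    exact (mul_le_of_le_one_left (norm_nonneg _) ht.2).trans hd_le
  have h2 : inner ℝ (gradient f (x + t • d)) d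
      = inner ℝ (act Q.transpose (gradient f x)) s
        + inner ℝ (gradient f (x + t • d) - gradient f x) d := by
    rw [inner_act_transpose, ← hd, inner_sub_left]; ring
  rw [h2]
  have h3 := (real_inner_le_norm (act Q.transpose (gradient f x)) s).trans
    (mul_le_mul_of_nonneg_left hs (norm_nonneg _))
  have h4 := (real_inner_le_norm (gradient f (x + t • d) - gradient f x) d).trans
    (mul_le_mul h1 hd_le (norm_nonneg _) (by positivity))
  calc _ ≤ _ := add_le_add h3 h4
    _ = _ := by ring

/-- If the model is fully linear and the projected gradient dominates the radius, then so does the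
model gradient. -/
lemma IsFullyLinear.le_norm_grad {f : E n → ℝ} {κef κeg δ : ℝ} {x : E n}
    {Q : Matrix (Fin n) (Fin p) ℝ} {m : QuadModel p} (hm : IsFullyLinear f κef κeg x δ Q m)
    (hδ : 0 < δ) : ‖act Q.transpose (gradient f x)‖ ≤ ‖m.grad‖ + κeg * δ := by
  have h := (hm 0 (by simpa using hδ.le)).2
  rw [m.gradient_eval, act_zero, act_zero, add_zero, add_zero] at h
  have := norm_le_insert' (act Q.transpose (gradient f x)) m.grad
  linarith

/-- Used with c = κ_h, where the factor `min 1 (c / κh)` is 1, and with c = η₂, which produces the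
minimum appearing in `C₂`. -/
lemma CauchyDecrease.le_of_le_norm_grad {N : Seminorm ℝ (Matrix (Fin p) (Fin p) ℝ)}
    {κfcd δ κh c : ℝ} {m : QuadModel p} {s : E p} (h : CauchyDecrease N κfcd δ m s)
    (hκfcd : 0 < κfcd) (hδ : 0 < δ) (hκh : 1 ≤ κh) (hN : N m.hess ≤ κh) (hg : c * δ ≤ ‖m.grad‖) :
    κfcd / 2 * ‖m.grad‖ * (min 1 (c / κh) * δ) ≤ m.eval 0 - m.eval s := by
  refine le_trans (mul_le_mul_of_nonneg_left ?_ (by positivity)) h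
  rw [min_mul_of_nonneg _ _ hδ.le, one_mul]
  refine min_le_min le_rfl ?_
  have h0 : 0 < max (N m.hess) 1 := lt_of_lt_of_le one_pos (le_max_right _ _)
  calc c / κh * δ = (c * δ) / κh := by ring
    _ ≤ ‖m.grad‖ / κh := by gcongr
    _ ≤ _ := by gcongr; exact max_le hN hκh

/-- Decrease of `f` along the trial step when the model is fully linear and the radius is small
compared to the projected gradient. -/
lemma IsFullyLinear.decrease {f : E n → ℝ} {κef κeg δ κfcd κh : ℝ} {x : E n}
    {Q : Matrix (Fin n) (Fin p) ℝ} {m : QuadModel p} {s : E p}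
    {N : Seminorm ℝ (Matrix (Fin p) (Fin p) ℝ)} (hm : IsFullyLinear f κef κeg x δ Q m)
    (hδ : 0 < δ) (hκef : 0 < κef) (hκeg : 0 < κeg) (hκfcd : 0 < κfcd) (hκh : 1 ≤ κh)
    (hN : N m.hess ≤ κh) (hs : ‖s‖ ≤ δ) (hc : CauchyDecrease N κfcd δ m s)
    (h1 : κh * δ ≤ ‖m.grad‖) (h2 : 8 * κef / κfcd * δ ≤ ‖m.grad‖) :
    C₁ κfcd κh κef κeg * ‖act Q.transpose (gradient f x)‖ * δ ≤ f x - f (x + act Q s) := by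
  have hκh0 : 0 < κh := one_pos.trans_le hκh
  have hh := hm.le_norm_grad hδ
  set h := ‖act Q.transpose (gradient f x)‖
  set g := ‖m.grad‖ with hg
  have hc' := hc.le_of_le_norm_grad hκfcd hδ hκh hN h1
  rw [div_self hκh0.ne', min_self, one_mul] at hc'
  have ha := abs_le.1 (hm 0 (by simpa using hδ.le)).1
  rw [act_zero, add_zero] at ha
  have hb := abs_le.1 (hm s hs).1
  have h2' : 8 * κef * δ ≤ κfcd * g := by
    have := mul_le_mul_of_nonneg_left h2 hκfcd.le
    rwa [← mul_assoc, mul_div_cancel₀ _ hκfcd.ne'] at this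
  -- The Cauchy decrease is at least (κ_fcd/2) g δ, and the model errors at the two endpoints cost
  -- 2κ_ef δ², which `h2'` bounds by half of it.
  have hdec : κfcd / 4 * g * δ ≤ f x - f (x + act Q s) := by
    have := mul_le_mul_of_nonneg_right h2' hδ.le
    nlinarith [ha.1, ha.2, hb.1, hb.2]
  refine le_trans (mul_le_mul_of_nonneg_right ?_ hδ.le) hdec
  rw [C₁, mul_assoc]
  refine mul_le_mul_of_nonneg_left ?_ (by positivity)
  -- Each entry of the maximum in `C₁` comes from h ≤ g + κ_eg δ with its own bound of δ by g: δ ≤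
  -- g/κ_h for the first, δ ≤ κ_fcd g/(8κ_ef) for the second.
  rw [max_mul_of_nonneg _ _ (norm_nonneg _)]
  refine max_le ?_ ?_
  · rw [div_mul_eq_mul_div, div_le_iff₀ (by positivity)]
    have := mul_le_mul_of_nonneg_left hh hκh0.le
    have := mul_le_mul_of_nonneg_left h1 hκeg.le
    linarith
  · rw [div_mul_eq_mul_div, div_le_iff₀ (by positivity)]
    have := mul_le_mul_of_nonneg_left hh hκef.le
    have := mul_le_mul_of_nonneg_left h2' hκeg.le
    linarith

/-- Iterations with a fully linear model, accurate estimates and a small radius are successful. -/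
lemma IsFullyLinear.success {f : E n → ℝ} {κef κeg δ κfcd κh εf f0 fs : ℝ} {x : E n}
    {Q : Matrix (Fin n) (Fin p) ℝ} {m : QuadModel p} {s : E p}
    {N : Seminorm ℝ (Matrix (Fin p) (Fin p) ℝ)} {P : Params n}
    (hm : IsFullyLinear f κef κeg x δ Q m) (ha : IsAccurate f εf x δ Q s f0 fs)
    (hδ : 0 < δ) (hεf : εf ≤ κef) (hκfcd : 0 < κfcd) (hκh : 1 ≤ κh)
    (hN : N m.hess ≤ κh) (hs : ‖s‖ ≤ δ) (hc : CauchyDecrease N κfcd δ m s)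
    (h0 : P.η₂ * δ ≤ ‖m.grad‖) (h1 : κh * δ ≤ ‖m.grad‖)
    (h2 : 8 * κef / (κfcd * (1 - P.η₁)) * δ ≤ ‖m.grad‖) : Success P δ m s f0 fs := by
  have hκh0 : 0 < κh := one_pos.trans_le hκh
  have hη : 0 < 1 - P.η₁ := sub_pos.2 P.η₁_lt_one
  refine ⟨?_, h0⟩
  have hc' := hc.le_of_le_norm_grad hκfcd hδ hκh hN h1
  rw [div_self hκh0.ne', min_self, one_mul] at hc'
  have h00 := abs_le.1 (hm 0 (by simpa using hδ.le)).1
  rw [act_zero, add_zero] at h00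
  have hb := abs_le.1 (hm s hs).1
  have ha1 := abs_le.1 ha.1
  have ha2 := abs_le.1 ha.2
  have hg : 0 < ‖m.grad‖ := (mul_pos hκh0 hδ).trans_le h1
  have hpos : 0 < m.eval 0 - m.eval s := lt_of_lt_of_le (by positivity) hc'
  have h2' : 8 * κef * δ ≤ κfcd * (1 - P.η₁) * ‖m.grad‖ := by
    have hp : 0 < κfcd * (1 - P.η₁) := mul_pos hκfcd hη
    have := mul_le_mul_of_nonneg_left h2 hp.le
    rwa [← mul_assoc, mul_div_cancel₀ _ hp.ne'] at this
  -- The actual numerator differs from the model decrease by at most 2κ_ef δ² + 2ε_f δ² ≤ 4κ_ef δ²,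
  -- and (1-η₁) times the model decrease exceeds this by `h2'`.
  rw [le_div_iff₀ hpos]
  have h3 := mul_le_mul_of_nonneg_right h2' hδ.le
  have h4 := mul_le_mul_of_nonneg_left hc' hη.le
  have h5 := mul_le_mul_of_nonneg_right hεf (sq_nonneg δ)
  nlinarith [h00.1, h00.2, hb.1, hb.2, ha1.1, ha1.2, ha2.1, ha2.2]

/-- Decrease of `f` on successful iterations with accurate estimates. -/
lemma IsAccurate.decrease {f : E n → ℝ} {δ κfcd κh εf f0 fs : ℝ} {x : E n}
    {Q : Matrix (Fin n) (Fin p) ℝ} {m : QuadModel p} {s : E p}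
    {N : Seminorm ℝ (Matrix (Fin p) (Fin p) ℝ)} {P : Params n}
    (ha : IsAccurate f εf x δ Q s f0 fs) (hsucc : Success P δ m s f0 fs)
    (hδ : 0 < δ) (hκfcd : 0 < κfcd) (hκh : 1 ≤ κh)
    (hN : N m.hess ≤ κh) (hc : CauchyDecrease N κfcd δ m s) :
    C₂ P.η₁ P.η₂ κfcd κh εf * δ ^ 2 ≤ f x - f (x + act Q s) := by
  have hκh0 : 0 < κh := one_pos.trans_le hκh
  have hη₁ := P.η₁_pos
  have hη₂ := P.η₂_pos
  have hg : 0 < ‖m.grad‖ := (mul_pos hη₂ hδ).trans_le hsucc.2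
  have hmin : 0 < min 1 (P.η₂ / κh) := lt_min one_pos (by positivity)
  have hc' := hc.le_of_le_norm_grad hκfcd hδ hκh hN hsucc.2
  have hpos : 0 < m.eval 0 - m.eval s := lt_of_lt_of_le (by positivity) hc'
  have h1 := (le_div_iff₀ hpos).1 hsucc.1
  have ha1 := abs_le.1 ha.1
  have ha2 := abs_le.1 ha.2
  have h2 : 1 / 2 * P.η₁ * P.η₂ * κfcd * min (P.η₂ / κh) 1 * δ ^ 2
      ≤ P.η₁ * (m.eval 0 - m.eval s) := by
    calc _ = P.η₁ * (κfcd / 2 * (P.η₂ * δ) * (min 1 (P.η₂ / κh) * δ)) := by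
          rw [min_comm]; ring
      _ ≤ P.η₁ * (κfcd / 2 * ‖m.grad‖ * (min 1 (P.η₂ / κh) * δ)) := by
          gcongr; exact hsucc.2
      _ ≤ _ := by gcongr
  rw [C₂, sub_mul]
  linarith [ha1.1, ha1.2, ha2.1, ha2.2]

end Deterministic

/-! ### Deterministic bounds on radii and iterates -/

section Trajectories

variable {Ω : Type*} {n p : ℕ} (P : Params n) (R : Run Ω n p)

lemma Params.γ_pos {n : ℕ} (P : Params n) : 0 < P.γ := one_pos.trans P.one_lt_γ

lemma Params.δmax_pos {n : ℕ} (P : Params n) : 0 < P.δmax :=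
  mul_pos (pow_pos P.γ_pos _) P.δ₀_pos

variable {P R} in
lemma iter_succ_of_success {k : ℕ} {ω : Ω}
    (h : Success P (radius P R k ω) (R.m k ω) (R.s k ω) (R.f0 k ω) (R.fs k ω)) :
    iter P R (k + 1) ω = iter P R k ω + act (R.Q k ω) (R.s k ω) := by
  unfold radius at h
  simp [iter, state, h]

variable {P R} in
lemma radius_succ_of_success {k : ℕ} {ω : Ω}
    (h : Success P (radius P R k ω) (R.m k ω) (R.s k ω) (R.f0 k ω) (R.fs k ω)) :
    radius P R (k + 1) ω = min (P.γ * radius P R k ω) P.δmax := by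
  unfold radius at h
  simp [radius, state, h]

variable {P R} in
lemma iter_succ_of_not_success {k : ℕ} {ω : Ω}
    (h : ¬ Success P (radius P R k ω) (R.m k ω) (R.s k ω) (R.f0 k ω) (R.fs k ω)) :
    iter P R (k + 1) ω = iter P R k ω := by
  unfold radius at h
  simp [iter, state, h]

variable {P R} in
lemma radius_succ_of_not_success {k : ℕ} {ω : Ω}
    (h : ¬ Success P (radius P R k ω) (R.m k ω) (R.s k ω) (R.f0 k ω) (R.fs k ω)) :
    radius P R (k + 1) ω = P.γ⁻¹ * radius P R k ω := by
  unfold radius at h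
  simp [radius, state, h]

lemma radius_pos (k : ℕ) (ω : Ω) : 0 < radius P R k ω := by
  induction k with
  | zero => exact P.δ₀_pos
  | succ k ih =>
    by_cases h : Success P (radius P R k ω) (R.m k ω) (R.s k ω) (R.f0 k ω) (R.fs k ω)
    · rw [radius_succ_of_success h]
      exact lt_min (mul_pos P.γ_pos ih) P.δmax_pos
    · rw [radius_succ_of_not_success h]
      exact mul_pos (inv_pos.2 P.γ_pos) ih

lemma radius_le_δmax (k : ℕ) (ω : Ω) : radius P R k ω ≤ P.δmax := by
  induction k with
  | zero => exact le_mul_of_one_le_left P.δ₀_pos.le (one_le_pow₀ P.one_lt_γ.le)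
  | succ k ih =>
    by_cases h : Success P (radius P R k ω) (R.m k ω) (R.s k ω) (R.f0 k ω) (R.fs k ω)
    · rw [radius_succ_of_success h]
      exact min_le_right _ _
    · rw [radius_succ_of_not_success h]
      exact (mul_le_of_le_one_left (radius_pos P R k ω).le
        (inv_le_one_of_one_le₀ P.one_lt_γ.le)).trans ih

variable {P R}

/-- Each step moves by at most q δ_max, so the k-th iterate stays in a deterministic ball.
Continuity of f and of its gradient then gives the boundedness behind integrability, with no global
growth condition on f. -/
lemma norm_iter_le {N : Seminorm ℝ (Matrix (Fin n) (Fin p) ℝ)} (hN : IsConsistentNorm N)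
    {q : ℝ} (hq : 0 ≤ q) (hQ : ∀ k ω, N (R.Q k ω) ≤ q)
    (hs : ∀ k ω, ‖R.s k ω‖ ≤ radius P R k ω) (k : ℕ) (ω : Ω) :
    ‖iter P R k ω‖ ≤ ‖P.x₀‖ + k * (q * P.δmax) := by
  have hnonneg : 0 ≤ q * P.δmax := mul_nonneg hq P.δmax_pos.le
  induction k with
  | zero => simp [iter, state]
  | succ k ih =>
    push_cast
    by_cases h : Success P (radius P R k ω) (R.m k ω) (R.s k ω) (R.f0 k ω) (R.fs k ω)
    · rw [iter_succ_of_success h]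
      have := norm_act_le hN (hQ k ω) ((hs k ω).trans (radius_le_δmax P R k ω))
      linarith [norm_add_le (iter P R k ω) (act (R.Q k ω) (R.s k ω))]
    · rw [iter_succ_of_not_success h]
      linarith

/-- A continuous function is bounded along the iterates with a given index. -/
lemma exists_norm_comp_iter_le {F : Type*} [SeminormedAddCommGroup F] {g : E n → F}
    (hg : Continuous g) {N : Seminorm ℝ (Matrix (Fin n) (Fin p) ℝ)} (hN : IsConsistentNorm N)
    {q : ℝ} (hq : 0 ≤ q) (hQ : ∀ k ω, N (R.Q k ω) ≤ q)
    (hs : ∀ k ω, ‖R.s k ω‖ ≤ radius P R k ω) (k : ℕ) :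
    ∃ C, ∀ ω, ‖g (iter P R k ω)‖ ≤ C := by
  obtain ⟨C, hC⟩ := (isCompact_closedBall (0 : E n)
    (‖P.x₀‖ + k * (q * P.δmax))).exists_bound_of_continuousOn hg.continuousOn
  exact ⟨C, fun ω => hC _ (by simpa using norm_iter_le hN hq hQ hs k ω)⟩

end Trajectories

/-! ### Measurability of the success and accuracy events -/

section Measurability

lemma QuadModel.measurable_const {p : ℕ} : Measurable (QuadModel.const : QuadModel p → ℝ) :=
  measurable_iff_comap_le.2 (le_sup_of_le_left le_sup_left)

lemma QuadModel.measurable_grad {p : ℕ} : Measurable (QuadModel.grad : QuadModel p → E p) :=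
  measurable_iff_comap_le.2 (le_sup_of_le_left le_sup_right)

lemma QuadModel.measurable_hess {p : ℕ} (i j : Fin p) :
    Measurable (fun m : QuadModel p => m.hess i j) :=
  measurable_iff_comap_le.2 (le_sup_of_le_right
    (le_iSup₂ (f := fun i j => MeasurableSpace.comap (fun m : QuadModel p => m.hess i j) _) i j))

variable {Ω : Type*} [MeasurableSpace Ω] {n p : ℕ}

lemma _root_.Measurable.act {a b : ℕ} {A : Ω → Matrix (Fin a) (Fin b) ℝ} {v : Ω → E b}
    (hA : ∀ i j, Measurable fun ω => A ω i j) (hv : Measurable v) :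
    Measurable fun ω => act (A ω) (v ω) := by
  refine (WithLp.measurable_toLp 2 _).comp (measurable_pi_lambda _ fun i => ?_)
  change Measurable fun ω => ∑ j, A ω i j * v ω j
  refine Finset.measurable_sum _ fun j _ => (hA i j).mul ?_
  exact (measurable_pi_apply j).comp ((WithLp.measurable_ofLp 2 _).comp hv)

lemma _root_.Measurable.quadModel_eval {m : Ω → QuadModel p} {s : Ω → E p} (hm : Measurable m)
    (hs : Measurable s) : Measurable fun ω => (m ω).eval (s ω) := by
  unfold QuadModel.eval
  exact ((QuadModel.measurable_const.comp hm).add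
    ((QuadModel.measurable_grad.comp hm).inner hs)).add
    ((hs.inner (.act (fun i j => (QuadModel.measurable_hess i j).comp hm) hs)).const_mul _)

lemma measurableSet_success (P : Params n) {δ f0 fs : Ω → ℝ} {m : Ω → QuadModel p} {s : Ω → E p}
    (hδ : Measurable δ) (hm : Measurable m) (hs : Measurable s) (hf0 : Measurable f0)
    (hfs : Measurable fs) :
    MeasurableSet {ω | Success P (δ ω) (m ω) (s ω) (f0 ω) (fs ω)} :=
  (measurableSet_le measurable_const
    ((hf0.sub hfs).div ((hm.quadModel_eval measurable_const).sub (hm.quadModel_eval hs)))).inter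
    (measurableSet_le (hδ.const_mul _) (QuadModel.measurable_grad.comp hm).norm)

lemma measurableSet_isAccurate {f : E n → ℝ} (hf : Continuous f) (ε : ℝ) {x : Ω → E n}
    {δ f0 fs : Ω → ℝ} {Q : Ω → Matrix (Fin n) (Fin p) ℝ} {s : Ω → E p}
    (hx : Measurable x) (hδ : Measurable δ) (hQ : ∀ i j, Measurable fun ω => Q ω i j)
    (hs : Measurable s) (hf0 : Measurable f0) (hfs : Measurable fs) :
    MeasurableSet {ω | IsAccurate f ε (x ω) (δ ω) (Q ω) (s ω) (f0 ω) (fs ω)} := by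
  have hr : Measurable fun ω => ε * δ ω ^ 2 := (hδ.pow_const 2).const_mul ε
  have h1 : Measurable fun ω => |f0 ω - f (x ω)| := (hf0.sub (hf.measurable.comp hx)).abs
  have h2 : Measurable fun ω => |fs ω - f (x ω + act (Q ω) (s ω))| :=
    (hfs.sub (hf.measurable.comp (hx.add (.act hQ hs)))).abs
  exact (measurableSet_le h1 hr).inter (measurableSet_le h2 hr)

/-- The condition ranges over uncountably many s in a ball of random radius. Writing s = δ t with t
in the fixed unit ball makes the index set deterministic, and since the condition is closed in t, a
countable dense set of t suffices. -/
lemma measurableSet_isFullyLinear {f : E n → ℝ} (hf : ContDiff ℝ 1 f) (κef κeg : ℝ)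
    {x : Ω → E n} {δ : Ω → ℝ} {Q : Ω → Matrix (Fin n) (Fin p) ℝ} {m : Ω → QuadModel p}
    (hx : Measurable x) (hδ : Measurable δ) (hQ : ∀ i j, Measurable fun ω => Q ω i j)
    (hm : Measurable m) (hpos : ∀ ω, 0 < δ ω) :
    MeasurableSet {ω | IsFullyLinear f κef κeg (x ω) (δ ω) (Q ω) (m ω)} := by
  have hg := hf.continuous_gradient
  obtain ⟨D, hD, hD'⟩ :=
    TopologicalSpace.exists_countable_dense (Metric.closedBall (0 : E p) 1)
  let c (ω : Ω) (t : E p) : Prop :=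
    |f (x ω + act (Q ω) (δ ω • t)) - (m ω).eval (δ ω • t)| ≤ κef * δ ω ^ 2 ∧
    ‖act (Q ω).transpose (gradient f (x ω + act (Q ω) (δ ω • t)))
      - ((m ω).grad + act (m ω).hess (δ ω • t))‖ ≤ κeg * δ ω
  have hiff : {ω | IsFullyLinear f κef κeg (x ω) (δ ω) (Q ω) (m ω)} = ⋂ t ∈ D, {ω | c ω t} := by
    ext ω
    simp only [Set.mem_ofPred_eq, Set.mem_iInter]
    constructor
    · intro h t _
      have ht := h (δ ω • (t : E p)) (by
        rw [norm_smul, Real.norm_of_nonneg (hpos ω).le]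
        exact mul_le_of_le_one_right (hpos ω).le (mem_closedBall_zero_iff.1 t.2))
      rwa [QuadModel.gradient_eval] at ht
    · intro h s hs
      have hcl : IsClosed {t : Metric.closedBall (0 : E p) 1 | c ω t} := by
        have hsm : Continuous fun t : Metric.closedBall (0 : E p) 1 => δ ω • (t : E p) :=
          by fun_prop
        have hy := continuous_const (y := x ω).add ((continuous_act (Q ω)).comp hsm)
        exact (isClosed_le ((hf.continuous.comp hy).sub
          ((m ω).continuous_eval.comp hsm)).abs continuous_const).inter
          (isClosed_le (((continuous_act _).comp (hg.comp hy)).sub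
            (continuous_const.add ((continuous_act _).comp hsm))).norm continuous_const)
      have hall : ∀ t : Metric.closedBall (0 : E p) 1, c ω t := fun t =>
        hcl.closure_subset_iff.2 h (hD' t)
      have ht := hall ⟨(δ ω)⁻¹ • s, by
        simpa [norm_smul, abs_of_pos (hpos ω), inv_mul_le_iff₀ (hpos ω)] using hs⟩
      simp only [c, smul_inv_smul₀ (hpos ω).ne'] at ht
      rwa [QuadModel.gradient_eval]
  rw [hiff]
  refine MeasurableSet.biInter hD fun t _ => ?_
  have hsm : Measurable fun ω => δ ω • (t : E p) := hδ.smul_const _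
  have hy : Measurable fun ω => x ω + act (Q ω) (δ ω • (t : E p)) := hx.add (.act hQ hsm)
  have h1 : Measurable fun ω =>
      |f (x ω + act (Q ω) (δ ω • (t : E p))) - (m ω).eval (δ ω • (t : E p))| :=
    ((hf.continuous.measurable.comp hy).sub (hm.quadModel_eval hsm)).abs
  have h2 : Measurable fun ω =>
      ‖act (Q ω).transpose (gradient f (x ω + act (Q ω) (δ ω • (t : E p))))
        - ((m ω).grad + act (m ω).hess (δ ω • (t : E p)))‖ :=
    ((Measurable.act (fun i j => hQ j i) (hg.measurable.comp hy)).sub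
      ((QuadModel.measurable_grad.comp hm).add
        (.act (fun i j => (QuadModel.measurable_hess i j).comp hm) hsm))).norm
  exact (measurableSet_le h1 ((hδ.pow_const 2).const_mul κef)).inter
    (measurableSet_le h2 (hδ.const_mul κeg))

end Measurability

/-! ### The filtration and adaptedness of the algorithm -/

section Filtration

variable {Ω : Type*} {n p : ℕ} (R : Run Ω n p)

lemma past_le_pastQ (k : ℕ) : past R k ≤ pastQ R k := le_sup_left

lemma pastQ_le_pastMQ (k : ℕ) : pastQ R k ≤ pastMQ R k := le_sup_left

lemma sigmaQ_le_pastQ (k : ℕ) : sigmaQ R k ≤ pastQ R k := le_sup_right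

lemma sigmaM_le_pastMQ (k : ℕ) : sigmaM R k ≤ pastMQ R k := le_sup_right

lemma past_mono {j k : ℕ} (h : j ≤ k) : past R j ≤ past R k :=
  iSup₂_mono' fun l hl => ⟨l, hl.trans_le h, le_rfl⟩

lemma le_past {l k : ℕ} (h : l < k) :
    MeasurableSpace.comap (R.f0 l) inferInstance ⊔ MeasurableSpace.comap (R.fs l) inferInstance ⊔
      sigmaM R l ⊔ sigmaQ R l ≤ past R k :=
  le_iSup₂ (f := fun (l : ℕ) (_ : l < k) =>
    MeasurableSpace.comap (R.f0 l) inferInstance ⊔ MeasurableSpace.comap (R.fs l) inferInstance ⊔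
      sigmaM R l ⊔ sigmaQ R l) l h

lemma pastMQ_le_past {l k : ℕ} (h : l < k) : pastMQ R l ≤ past R k :=
  sup_le (sup_le (past_mono R h.le) (le_sup_right.trans (le_past R h)))
    ((le_sup_right.trans le_sup_left).trans (le_past R h))

lemma measurable_entry_sigmaQ (k : ℕ) (i : Fin n) (j : Fin p) :
    Measurable[sigmaQ R k] fun ω => R.Q k ω i j :=
  measurable_iff_comap_le.2
    (le_iSup₂ (f := fun i j => MeasurableSpace.comap (fun ω => R.Q k ω i j) _) i j)

lemma measurable_model_sigmaM (k : ℕ) : Measurable[sigmaM R k] (R.m k) :=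
  comap_measurable _

variable {R}

lemma pastMQ_le [MeasurableSpace Ω] (hR : R.IsRandom) (k : ℕ) : pastMQ R k ≤ ‹_› := by
  have hQ (l : ℕ) : sigmaQ R l ≤ ‹MeasurableSpace Ω› :=
    iSup₂_le fun i j => (hR.measurable_Q l i j).comap_le
  have hM (l : ℕ) : sigmaM R l ≤ ‹MeasurableSpace Ω› := (hR.measurable_m l).comap_le
  exact sup_le (sup_le (iSup₂_le fun l _ => sup_le (sup_le (sup_le (hR.measurable_f0 l).comap_le
    (hR.measurable_fs l).comap_le) (hM l)) (hQ l)) (hQ k)) (hM k)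

lemma pastQ_le [MeasurableSpace Ω] (hR : R.IsRandom) (k : ℕ) : pastQ R k ≤ ‹_› :=
  (pastQ_le_pastMQ R k).trans (pastMQ_le hR k)

/-- One step of the algorithm is measurable. -/
lemma measurable_state_succ [MeasurableSpace Ω] {P : Params n} {k : ℕ}
    (hstate : Measurable (state P R k)) (hQ : ∀ i j, Measurable fun ω => R.Q k ω i j)
    (hm : Measurable (R.m k)) (hs : Measurable (R.s k)) (hf0 : Measurable (R.f0 k))
    (hfs : Measurable (R.fs k)) : Measurable (state P R (k + 1)) := by
  classical
  refine Measurable.ite (measurableSet_success P hstate.snd hm hs hf0 hfs) ?_ ?_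
  · exact (hstate.fst.add (.act hQ hs)).prodMk ((hstate.snd.const_mul _).min measurable_const)
  · exact hstate.fst.prodMk (hstate.snd.const_mul _)

/-- Trial steps are not among the generators of `past`, but the step of iteration l < k is `pastMQ R
l`-measurable, and that σ-algebra lies in `past R k`. -/
lemma measurable_state_past [MeasurableSpace Ω] (hR : R.IsRandom) (P : Params n) (k : ℕ) :
    Measurable[past R k] (state P R k) := by
  induction k with
  | zero => exact measurable_const
  | succ k ih =>
    have hk := k.lt_succ_self
    refine @measurable_state_succ Ω n p R (past R (k + 1)) P k
      (ih.mono (past_mono R hk.le) le_rfl)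
      (fun i j => (measurable_entry_sigmaQ R k i j).mono
        (le_sup_right.trans (le_past R hk)) le_rfl)
      ((measurable_model_sigmaM R k).mono
        ((le_sup_right.trans le_sup_left).trans (le_past R hk)) le_rfl)
      ((hR.measurable_s k).mono (pastMQ_le_past R hk) le_rfl) ?_ ?_
    · exact measurable_iff_comap_le.2
        (((le_sup_left.trans le_sup_left).trans le_sup_left).trans (le_past R hk))
    · exact measurable_iff_comap_le.2
        (((le_sup_right.trans le_sup_left).trans le_sup_left).trans (le_past R hk))

lemma measurable_iter_pastQ [MeasurableSpace Ω] (hR : R.IsRandom) (P : Params n) (k : ℕ) :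
    Measurable[pastQ R k] (iter P R k) :=
  ((measurable_state_past hR P k).fst).mono (past_le_pastQ R k) le_rfl

lemma measurable_radius_pastQ [MeasurableSpace Ω] (hR : R.IsRandom) (P : Params n) (k : ℕ) :
    Measurable[pastQ R k] (radius P R k) :=
  ((measurable_state_past hR P k).snd).mono (past_le_pastQ R k) le_rfl

lemma measurable_entry_pastQ (k : ℕ) (i : Fin n) (j : Fin p) :
    Measurable[pastQ R k] fun ω => R.Q k ω i j :=
  (measurable_entry_sigmaQ R k i j).mono (sigmaQ_le_pastQ R k) le_rfl

/-- Measurability with respect to `pastMQ`, not just the ambient σ-algebra, lets the model event be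
treated as known when conditioning the estimate event. -/
lemma measurableSet_goodModel [MeasurableSpace Ω] (hR : R.IsRandom) (P : Params n)
    {f : E n → ℝ} (hf : ContDiff ℝ 1 f) (κef κeg : ℝ) (k : ℕ) :
    MeasurableSet[pastMQ R k] (goodModel P R f κef κeg k) :=
  have h := pastQ_le_pastMQ R k
  @measurableSet_isFullyLinear Ω (pastMQ R k) n p f hf κef κeg _ _ _ _
    ((measurable_iter_pastQ hR P k).mono h le_rfl) ((measurable_radius_pastQ hR P k).mono h le_rfl)
    (fun i j => (measurable_entry_pastQ k i j).mono h le_rfl)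
    ((measurable_model_sigmaM R k).mono (sigmaM_le_pastMQ R k) le_rfl) (radius_pos P R k)

lemma measurableSet_goodEstimates [MeasurableSpace Ω] (hR : R.IsRandom) (P : Params n)
    {f : E n → ℝ} (hf : Continuous f) (ε : ℝ) (k : ℕ) :
    MeasurableSet (goodEstimates P R f ε k) :=
  have h := pastQ_le hR k
  measurableSet_isAccurate hf ε ((measurable_iter_pastQ hR P k).mono h le_rfl)
    ((measurable_radius_pastQ hR P k).mono h le_rfl) (hR.measurable_Q k)
    ((hR.measurable_s k).mono (pastMQ_le hR k) le_rfl) (hR.measurable_f0 k) (hR.measurable_fs k)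

end Filtration

/-! ### Conditional probabilities of joint events -/

section Conditional

variable {Ω : Type*} {F G m0 : MeasurableSpace Ω} {μ : Measure Ω} [IsProbabilityMeasure μ]

lemma integrable_indicator_one {s : Set Ω} (hs : MeasurableSet s) :
    Integrable (s.indicator fun _ => (1 : ℝ)) μ := (integrable_const _).indicator hs

lemma condProb_compl (hF : F ≤ m0) {s : Set Ω} (hs : MeasurableSet s) :
    μ⟦sᶜ | F⟧ =ᵐ[μ] fun ω => 1 - (μ⟦s | F⟧) ω := by
  have h : (sᶜ.indicator fun _ => (1 : ℝ)) = (fun _ => (1 : ℝ)) - s.indicator fun _ => (1 : ℝ) := by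
    rw [Set.indicator_compl]
  rw [h]
  filter_upwards [condExp_sub (integrable_const (1 : ℝ)) (integrable_indicator_one hs) F] with ω hω
  rw [hω, condExp_const hF]
  rfl

/-- `ℙ(K ∩ J | 𝓕)` is the conditional expectation of `1_K ℙ(J | 𝓖)`, if `K ∈ 𝓖 ⊇ 𝓕`. -/
lemma condProb_inter (hFG : F ≤ G) (hG : G ≤ m0) {K J : Set Ω} (hK : MeasurableSet[G] K)
    (hJ : MeasurableSet J) : μ[K.indicator (μ⟦J | G⟧) | F] =ᵐ[μ] μ⟦K ∩ J | F⟧ := by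
  have h1 : ((K ∩ J).indicator fun _ => (1 : ℝ)) = K.indicator (J.indicator fun _ => (1 : ℝ)) := by
    rw [Set.indicator_indicator]
  rw [h1]
  exact (condExp_congr_ae (condExp_indicator (integrable_indicator_one hJ) hK).symm).trans
    (condExp_condExp_of_le hFG hG)

/-- Multiply the bound on the inner conditional probability by the indicator of K, condition on the
smaller σ-algebra, and apply the tower property. -/
lemma mul_condProb_le_condProb_inter (hFG : F ≤ G) (hG : G ≤ m0) {K J : Set Ω}
    (hK : MeasurableSet[G] K) (hJ : MeasurableSet J) {c : ℝ} (hc : ∀ᵐ ω ∂μ, c ≤ (μ⟦J | G⟧) ω) :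
    ∀ᵐ ω ∂μ, c * (μ⟦K | F⟧) ω ≤ (μ⟦K ∩ J | F⟧) ω := by
  have h := condExp_mono (m := F) ((integrable_indicator_one (μ := μ) (hG _ hK)).smul c)
    (integrable_condExp.indicator (hG _ hK) : Integrable (K.indicator (μ⟦J | G⟧)) μ) (by
      filter_upwards [hc] with ω hω
      by_cases hωK : ω ∈ K <;> simp [hωK, hω])
  filter_upwards [h, condExp_smul (μ := μ) c (K.indicator fun _ => (1 : ℝ)) F,
    condProb_inter (μ := μ) hFG hG hK hJ] with ω h1 h2 h3
  rw [h2, h3] at h1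
  exact h1

lemma condProb_inter_le_mul_condProb (hFG : F ≤ G) (hG : G ≤ m0) {K J : Set Ω}
    (hK : MeasurableSet[G] K) (hJ : MeasurableSet J) {c : ℝ} (hc : ∀ᵐ ω ∂μ, (μ⟦J | G⟧) ω ≤ c) :
    ∀ᵐ ω ∂μ, (μ⟦K ∩ J | F⟧) ω ≤ c * (μ⟦K | F⟧) ω := by
  have h := condExp_mono (m := F)
    (integrable_condExp.indicator (hG _ hK) : Integrable (K.indicator (μ⟦J | G⟧)) μ)
    ((integrable_indicator_one (μ := μ) (hG _ hK)).smul c) (by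
      filter_upwards [hc] with ω hω
      by_cases hωK : ω ∈ K <;> simp [hωK, hω])
  filter_upwards [h, condExp_smul (μ := μ) c (K.indicator fun _ => (1 : ℝ)) F,
    condProb_inter (μ := μ) hFG hG hK hJ] with ω h1 h2 h3
  rw [h2, h3] at h1
  exact h1

/-- Bounds for the conditional probabilities of joint events, if `I ∈ 𝓖 ⊇ 𝓕`. -/
lemma condProb_bounds (hFG : F ≤ G) (hG : G ≤ m0) {I J : Set Ω} (hI : MeasurableSet[G] I)
    (hJ : MeasurableSet J) {β β' : ℝ} (hβ'₀ : 0 ≤ β') (hβ'₁ : β' ≤ 1)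
    (h : ∀ᵐ ω ∂μ, β ≤ (μ⟦I | F⟧) ω) (h' : ∀ᵐ ω ∂μ, β' ≤ (μ⟦J | G⟧) ω) :
    ∀ᵐ ω ∂μ, β' * β ≤ (μ⟦I ∩ J | F⟧) ω ∧ (μ⟦Iᶜ ∩ Jᶜ | F⟧) ω ≤ (1 - β') * (1 - β) ∧
      (μ⟦Jᶜ | F⟧) ω ≤ 1 - β' := by
  have hJc : ∀ᵐ ω ∂μ, (μ⟦Jᶜ | G⟧) ω ≤ 1 - β' := by
    filter_upwards [h', condProb_compl (μ := μ) hG hJ] with ω h1 h2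
    rw [h2]; linarith
  -- The case K = Ω transfers the bound on bad estimates from 𝓖 to 𝓕.
  have hu := condProb_inter_le_mul_condProb hFG hG MeasurableSet.univ hJ.compl hJc
  rw [Set.univ_inter, Set.indicator_univ, condExp_const (hFG.trans hG)] at hu
  filter_upwards [h, mul_condProb_le_condProb_inter hFG hG hI hJ h',
    condProb_inter_le_mul_condProb hFG hG hI.compl hJ.compl hJc,
    condProb_compl (μ := μ) (hFG.trans hG) (hG _ hI), hu] with ω h1 h2 h3 h4 h5
  refine ⟨(mul_le_mul_of_nonneg_left h1 hβ'₀).trans h2, h3.trans ?_, by linarith⟩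
  rw [h4]
  exact mul_le_mul_of_nonneg_left (by linarith) (by linarith)

lemma condExp_mul_indicator (hF : F ≤ m0) {a : Ω → ℝ} {U : Set Ω} (hU : MeasurableSet U)
    (ha : StronglyMeasurable[F] a) (hb : ∃ C, ∀ ω, ‖a ω‖ ≤ C) :
    Integrable (a * U.indicator fun _ => (1 : ℝ)) μ ∧
      μ[a * U.indicator (fun _ => (1 : ℝ)) | F] =ᵐ[μ] a * μ⟦U | F⟧ := by
  obtain ⟨C, hC⟩ := hb
  exact ⟨(integrable_indicator_one hU).bdd_mul (ha.mono hF).aestronglyMeasurable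
    (ae_of_all _ hC), condExp_stronglyMeasurable_mul_of_bound hF ha (integrable_indicator_one hU) C
    (ae_of_all _ hC)⟩

/-- Conditional expectation of a quantity dominated by a combination of indicators with
coefficients that are known at the time of conditioning. -/
lemma condExp_le_of_le_indicators (hF : F ≤ m0) {Δ b a d e : Ω → ℝ} {U V W : Set Ω}
    (hU : MeasurableSet U) (hV : MeasurableSet V) (hW : MeasurableSet W) (hΔ : Integrable Δ μ)
    (hb : StronglyMeasurable[F] b ∧ ∃ C, ∀ ω, ‖b ω‖ ≤ C)
    (ha : StronglyMeasurable[F] a ∧ ∃ C, ∀ ω, ‖a ω‖ ≤ C)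
    (hd : StronglyMeasurable[F] d ∧ ∃ C, ∀ ω, ‖d ω‖ ≤ C)
    (he : StronglyMeasurable[F] e ∧ ∃ C, ∀ ω, ‖e ω‖ ≤ C)
    (h : ∀ ω, Δ ω ≤ b ω + a ω * U.indicator (fun _ => 1) ω + d ω * V.indicator (fun _ => 1) ω
      + e ω * W.indicator (fun _ => 1) ω) :
    ∀ᵐ ω ∂μ, (μ[Δ | F]) ω ≤ b ω + a ω * (μ⟦U | F⟧) ω + d ω * (μ⟦V | F⟧) ω
      + e ω * (μ⟦W | F⟧) ω := by
  obtain ⟨Cb, hCb⟩ := hb.2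
  have hbi : Integrable b μ := Integrable.of_bound (hb.1.mono hF).aestronglyMeasurable Cb
    (ae_of_all _ hCb)
  obtain ⟨ia, ea⟩ := condExp_mul_indicator (μ := μ) hF hU ha.1 ha.2
  obtain ⟨id, ed⟩ := condExp_mul_indicator (μ := μ) hF hV hd.1 hd.2
  obtain ⟨ie, ee⟩ := condExp_mul_indicator (μ := μ) hF hW he.1 he.2
  filter_upwards [condExp_mono (m := F) hΔ (((hbi.add ia).add id).add ie) (ae_of_all _ h),
    condExp_add ((hbi.add ia).add id) ie F, condExp_add (hbi.add ia) id F, condExp_add hbi ia F,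
    ea, ed, ee] with ω h1 h2 h3 h4 h5 h6 h7
  rw [h2, Pi.add_apply, h3, Pi.add_apply, h4, Pi.add_apply, h5, h6, h7,
    condExp_of_stronglyMeasurable hF hb.1 hbi] at h1
  exact h1

end Conditional

/-- If the expected decrease of a nonnegative process dominates the expectation of `r k ≥ 0`, then
`∑ k, r k` converges almost surely. -/
lemma ae_summable_of_integral_descent {Ω : Type*} [MeasurableSpace Ω] {μ : Measure Ω}
    {φ r : ℕ → Ω → ℝ} (hφ : ∀ k ω, 0 ≤ φ k ω)
    (hr : ∀ k ω, 0 ≤ r k ω) (hri : ∀ k, Integrable (r k) μ) {c : ℝ} (hc : 0 < c)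
    (h : ∀ k, c * ∫ ω, r k ω ∂μ ≤ ∫ ω, φ k ω ∂μ - ∫ ω, φ (k + 1) ω ∂μ) :
    ∀ᵐ ω ∂μ, Summable fun k => r k ω := by
  have hsum : Summable fun k => ∫ ω, r k ω ∂μ := by
    refine summable_of_sum_range_le (c := (∫ ω, φ 0 ω ∂μ) / c)
      (fun k => integral_nonneg (hr k)) fun N => ?_
    rw [le_div_iff₀' hc, Finset.mul_sum]
    calc _ ≤ ∑ k ∈ Finset.range N, (∫ ω, φ k ω ∂μ - ∫ ω, φ (k + 1) ω ∂μ) :=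
          Finset.sum_le_sum fun k _ => h k
      _ = ∫ ω, φ 0 ω ∂μ - ∫ ω, φ N ω ∂μ := Finset.sum_range_sub' _ _
      _ ≤ _ := sub_le_self _ (integral_nonneg (hφ N))
  have hmeas : ∀ k, AEMeasurable (fun ω => ENNReal.ofReal (r k ω)) μ := fun k =>
    (hri k).aemeasurable.ennreal_ofReal
  have hfin : ∫⁻ ω, ∑' k, ENNReal.ofReal (r k ω) ∂μ ≠ ⊤ := by
    rw [lintegral_tsum hmeas]
    simp_rw [← fun k => ofReal_integral_eq_lintegral_ofReal (hri k) (ae_of_all _ (hr k))]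
    exact hsum.tsum_ofReal_ne_top
  filter_upwards [ae_lt_top' (AEMeasurable.tsum hmeas) hfin] with ω hω
  have := ENNReal.summable_toReal hω.ne
  simpa only [ENNReal.toReal_ofReal (hr _ ω)] using this

/-! ### Numerical inequalities behind the choice of ν, β_f and β_m -/

section Arithmetic

/-- The bound for the expected change of the merit function when the radius is small compared to the
projected gradient (`X = h δ`, `Y = δ²`). -/
lemma expected_bound_of_small_radius {γ ν c₁ c₃ ζ βf βm X Y p₁ p₂ : ℝ} (hγ : 1 < γ)
    (hν : ν ∈ Set.Ioo (0 : ℝ) 1) (hc₁ : 0 < c₁) (hc₃ : 0 ≤ c₃) (hβf : βf ∈ Set.Ioo (0 : ℝ) 1)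
    (hβm : βm ∈ Set.Ioo (0 : ℝ) 1) (hX : ζ * Y ≤ X) (hX0 : 0 ≤ X) (hY : 0 ≤ Y)
    (h1 : (1 - ν) * (8 * γ ^ 2) ≤ ν * (ζ * c₁))
    (hβ : c₃ / c₁ ≤ (βf * βm - 1 / 2) / ((1 - βf) + (1 - βm)))
    (hp₁ : βf * βm ≤ p₁) (hp₂ : p₂ ≤ (1 - βf) * (1 - βm)) :
    -((1 - ν) * (1 - 1 / γ ^ 2)) * Y
      + (-(ν * c₁) * X + ((1 - ν) * (γ ^ 2 - 1) + (1 - ν) * (1 - 1 / γ ^ 2)) * Y) * p₁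
      + (ν * c₃ * X + ((1 - ν) * (γ ^ 2 - 1) + (1 - ν) * (1 - 1 / γ ^ 2)) * Y) * p₂
      ≤ -(1 / 2 * βf * (1 - ν) * (1 - 1 / γ ^ 2)) * Y := by
  obtain ⟨hν0, hν1⟩ := hν
  obtain ⟨hf0, hf1⟩ := hβf
  obtain ⟨hm0, hm1⟩ := hβm
  have hν' : 0 < 1 - ν := sub_pos.2 hν1
  have hγ2 : 1 < γ ^ 2 := one_lt_pow₀ hγ two_ne_zero
  have hu0 : 0 < 1 - 1 / γ ^ 2 := sub_pos.2 ((div_lt_one (by positivity)).2 hγ2)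
  have hu1 : 1 - 1 / γ ^ 2 ≤ 1 := by simp; positivity
  generalize 1 - 1 / γ ^ 2 = u at *
  have hXY : (1 - ν) * (8 * γ ^ 2) * Y ≤ ν * c₁ * X := by
    have e1 := mul_le_mul_of_nonneg_right h1 hY
    have e2 := mul_le_mul_of_nonneg_left hX (mul_nonneg hν0.le hc₁.le)
    linarith
  have hS : 0 < (1 - βf) + (1 - βm) := by linarith
  -- The hypothesis has the sum (1-β_f) + (1-β_m) in its denominator, which dominates the product
  -- needed here.
  have hkey : c₃ * ((1 - βf) * (1 - βm)) ≤ c₁ * (βf * βm - 1 / 2) := by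
    rw [div_le_div_iff₀ hc₁ hS] at hβ
    have : c₃ * ((1 - βf) * (1 - βm)) ≤ c₃ * ((1 - βf) + (1 - βm)) :=
      mul_le_mul_of_nonneg_left (by nlinarith) hc₃
    linarith
  obtain ⟨g, hg⟩ : ∃ g, g = (1 - ν) * (γ ^ 2 - 1) + (1 - ν) * u := ⟨_, rfl⟩
  rw [← hg]
  have hg0 : 0 ≤ g := by
    rw [hg]
    exact add_nonneg (mul_nonneg hν'.le (sub_nonneg.2 hγ2.le)) (mul_nonneg hν'.le hu0.le)
  have hνY : 0 ≤ (1 - ν) * Y := mul_nonneg hν'.le hY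
  have hgY : g * Y ≤ (1 - ν) * (8 * γ ^ 2) * Y := by
    rw [hg]
    nlinarith [mul_nonneg hνY (sub_nonneg.2 hγ2.le), mul_nonneg hνY (sub_nonneg.2 hu1)]
  -- The coefficient of p₁ is nonpositive and that of p₂ nonnegative, so the lower bound on p₁ and
  -- the upper bound on p₂ can be substituted.
  have ha : -(ν * c₁) * X + g * Y ≤ 0 := by linarith
  have hd : 0 ≤ ν * c₃ * X + g * Y :=
    add_nonneg (mul_nonneg (mul_nonneg hν0.le hc₃) hX0) (mul_nonneg hg0 hY)
  have e1 := mul_le_mul_of_nonpos_left hp₁ ha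
  have e2 := mul_le_mul_of_nonneg_left hp₂ hd
  have e3 := mul_le_mul_of_nonneg_left hkey (mul_nonneg hν0.le hX0)
  have e4 : g * Y * (βf * βm + (1 - βf) * (1 - βm)) ≤ g * Y :=
    mul_le_of_le_one_right (mul_nonneg hg0 hY) (by nlinarith)
  have e5 : g * Y - (1 - ν) * u * Y = (1 - ν) * (γ ^ 2 - 1) * Y := by rw [hg]; ring
  have e6 : 1 / 2 * βf * (1 - ν) * u * Y ≤ (1 - ν) * Y := by
    have e8 : βf * u ≤ 1 := mul_le_one₀ hf1.le hu0.le hu1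
    calc 1 / 2 * βf * (1 - ν) * u * Y = 1 / 2 * (βf * u) * ((1 - ν) * Y) := by ring
      _ ≤ 1 * ((1 - ν) * Y) := mul_le_mul_of_nonneg_right (by linarith) hνY
      _ = _ := one_mul _
  have e7 : 0 ≤ (1 - ν) * γ ^ 2 * Y := by positivity
  calc _ ≤ -((1 - ν) * u) * Y + (-(ν * c₁) * X + g * Y) * (βf * βm)
        + (ν * c₃ * X + g * Y) * ((1 - βf) * (1 - βm)) :=
        add_le_add (add_le_add le_rfl e1) e2
    _ = ν * X * (c₃ * ((1 - βf) * (1 - βm)) - c₁ * (βf * βm))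
        + g * Y * (βf * βm + (1 - βf) * (1 - βm)) - (1 - ν) * u * Y := by ring
    _ ≤ -(1 / 2) * (ν * c₁ * X) + g * Y - (1 - ν) * u * Y := by linarith
    _ ≤ -(1 / 2) * (ν * c₁ * X) + (1 - ν) * (γ ^ 2 - 1) * Y := by linarith
    _ ≤ -((1 - ν) * Y) := by linarith
    _ ≤ _ := by linarith

/-- The bound for the expected change of the merit function when the radius is large compared to the
projected gradient (`Y = δ²`). -/
lemma expected_bound_of_large_radius {γ ν c₃ ζ βf Y p₃ : ℝ} (hγ : 1 < γ)
    (hν : ν ∈ Set.Ioo (0 : ℝ) 1) (hc₃ : 0 ≤ c₃) (hζ : 0 < ζ) (hβf : βf ∈ Set.Ioo (0 : ℝ) 1)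
    (hY : 0 ≤ Y)
    (hβ : 2 * ν * ζ * γ ^ 2 * c₃ / ((1 - ν) * (γ ^ 2 - 1)) + 2 * γ ^ 2 ≤ βf / (1 - βf))
    (hp₃ : p₃ ≤ 1 - βf) :
    -((1 - ν) * (1 - 1 / γ ^ 2)) * Y
      + (ν * c₃ * ζ + (1 - ν) * (γ ^ 2 - 1) + (1 - ν) * (1 - 1 / γ ^ 2)) * Y * p₃
      ≤ -(1 / 2 * βf * (1 - ν) * (1 - 1 / γ ^ 2)) * Y := by
  obtain ⟨hν0, hν1⟩ := hν
  obtain ⟨hf0, hf1⟩ := hβf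
  have hν' : 0 < 1 - ν := sub_pos.2 hν1
  have hγ2 : 1 < γ ^ 2 := one_lt_pow₀ hγ two_ne_zero
  have hγ0 : 0 < γ ^ 2 := one_pos.trans hγ2
  have hw : 0 < (1 - ν) * (γ ^ 2 - 1) := mul_pos hν' (sub_pos.2 hγ2)
  have hu : (1 - ν) * (1 - 1 / γ ^ 2) = (1 - ν) * (γ ^ 2 - 1) / γ ^ 2 := by field_simp
  have hu' : 1 / 2 * βf * (1 - ν) * (1 - 1 / γ ^ 2)
      = 1 / 2 * βf * ((1 - ν) * (γ ^ 2 - 1) / γ ^ 2) := by rw [← hu]; ring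
  rw [hu, hu']
  generalize (1 - ν) * (γ ^ 2 - 1) = w at *
  set u := w / γ ^ 2 with hudef
  have hu0 : 0 < u := by positivity
  -- Multiplying `hβ` by u/2 turns its left side into exactly νc₃ζ + w. Bad estimates then cost at
  -- most β_f u/2 plus the lost shrinkage (1-β_f)u, leaving -β_f u/2: hence the 1/2 in ϱ.
  have hkey : (1 - βf) * (ν * c₃ * ζ + w) ≤ 1 / 2 * βf * u := by
    rw [le_div_iff₀ (sub_pos.2 hf1)] at hβ
    have e := mul_le_mul_of_nonneg_left hβ (half_pos hu0).le
    calc _ = u / 2 * ((2 * ν * ζ * γ ^ 2 * c₃ / w + 2 * γ ^ 2) * (1 - βf)) := by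
          rw [hudef]; field_simp
      _ ≤ _ := e
      _ = _ := by ring
  have hpos : 0 ≤ (ν * c₃ * ζ + w + u) * Y := by positivity
  have e1 := mul_le_mul_of_nonneg_left hp₃ hpos
  have e2 := mul_le_mul_of_nonneg_right hkey hY
  linarith

end Arithmetic

/-! ### Pathwise change of the merit function -/

section OneStep

variable {Ω : Type*} {n p : ℕ} {P : Params n} {R : Run Ω n p} {f : E n → ℝ} {k : ℕ} {ω : Ω}

variable (P R f) in
/-- The norm of the projected gradient `‖Q_kᵀ ∇f(x_k)‖`. -/
noncomputable def projGrad (k : ℕ) (ω : Ω) : ℝ :=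
  ‖act (R.Q k ω).transpose (gradient f (iter P R k ω))‖

lemma C₁_pos {κfcd κh κef κeg : ℝ} (hκfcd : 0 < κfcd) (hκh : 0 < κh) (hκeg : 0 < κeg) :
    0 < C₁ κfcd κh κef κeg :=
  mul_pos (by positivity) (lt_max_of_lt_left (by positivity))

lemma C₂_pos {η₁ η₂ κfcd κh εf : ℝ} (h : εf < 1 / 4 * η₁ * η₂ * κfcd * min (η₂ / κh) 1) :
    0 < C₂ η₁ η₂ κfcd κh εf := by
  rw [C₂]; linarith

lemma C₃_nonneg {Lg Qmax ζ : ℝ} (hLg : 0 ≤ Lg) (hζ : 0 < ζ) : 0 ≤ C₃ Lg Qmax ζ := by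
  rw [C₃]; positivity

lemma merit_nonneg {fmin ν : ℝ} (hfmin : ∀ x, fmin ≤ f x) (hν : ν ∈ Set.Ioo (0 : ℝ) 1) :
    0 ≤ merit P R f fmin ν k ω :=
  add_nonneg (mul_nonneg hν.1.le (sub_nonneg.2 (hfmin _)))
    (mul_nonneg (sub_nonneg.2 hν.2.le) (sq_nonneg _))

lemma merit_succ_sub_of_not_success (fmin ν : ℝ)
    (h : ¬ Success P (radius P R k ω) (R.m k ω) (R.s k ω) (R.f0 k ω) (R.fs k ω)) :
    merit P R f fmin ν (k + 1) ω - merit P R f fmin ν k ω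
      = -((1 - ν) * (1 - 1 / P.γ ^ 2)) * radius P R k ω ^ 2 := by
  rw [merit, merit, iter_succ_of_not_success h, radius_succ_of_not_success h]
  ring

/-- The number D may be negative: the lemma also serves when only a bound on the increase of f is
available. -/
lemma merit_succ_sub_le_of_success (fmin : ℝ) {ν D : ℝ} (hν : ν ∈ Set.Ioo (0 : ℝ) 1)
    (h : Success P (radius P R k ω) (R.m k ω) (R.s k ω) (R.f0 k ω) (R.fs k ω))
    (hD : D ≤ f (iter P R k ω) - f (iter P R k ω + act (R.Q k ω) (R.s k ω))) :
    merit P R f fmin ν (k + 1) ω - merit P R f fmin ν k ω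
      ≤ -(ν * D) + (1 - ν) * (P.γ ^ 2 - 1) * radius P R k ω ^ 2 := by
  rw [merit, merit, iter_succ_of_success h]
  have h1 : radius P R (k + 1) ω ^ 2 ≤ (P.γ * radius P R k ω) ^ 2 :=
    pow_le_pow_left₀ (radius_pos P R _ ω).le
      ((radius_succ_of_success h).trans_le (min_le_left _ _)) 2
  have h2 := mul_le_mul_of_nonneg_left h1 (sub_nonneg.2 hν.2.le)
  have h3 := mul_le_mul_of_nonneg_left hD hν.1.le
  linarith

/-- A large enough decrease of `f` compensates the growth of the radius. -/
lemma growth_le_shrink {γ ν c Y : ℝ} (hγ : 1 < γ) (hν : ν ∈ Set.Ioo (0 : ℝ) 1) (hY : 0 ≤ Y)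
    (hc : (1 - ν) * (8 * γ ^ 2) ≤ ν * c) :
    -(ν * (c * Y)) + (1 - ν) * (γ ^ 2 - 1) * Y ≤ -((1 - ν) * (1 - 1 / γ ^ 2)) * Y := by
  have h1 := mul_le_mul_of_nonneg_right hc hY
  have h2 : 0 ≤ (1 - ν) * Y := mul_nonneg (sub_nonneg.2 hν.2.le) hY
  have h3 : 0 ≤ (1 - ν) * Y * γ ^ 2 := mul_nonneg h2 (sq_nonneg γ)
  have h4 : 0 ≤ (1 - ν) * Y * (1 / γ ^ 2) := mul_nonneg h2 (by positivity)
  linarith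

/-- Pathwise bound for the change of the merit function. -/
theorem merit_succ_sub_le (hf : ContDiff ℝ 1 f) (fmin : ℝ) {Lg : ℝ≥0}
    (hLg : LipschitzOnWith Lg (gradient f) (region P R ω))
    {normQ : Seminorm ℝ (Matrix (Fin n) (Fin p) ℝ)} (hnormQ : IsConsistentNorm normQ)
    {normH : Seminorm ℝ (Matrix (Fin p) (Fin p) ℝ)}
    {Qmax : ℝ} (hQ : normQ (R.Q k ω) ≤ Qmax)
    {κh : ℝ} (hκh : 1 ≤ κh) (hH : normH (R.m k ω).hess ≤ κh)
    {κfcd : ℝ} (hκfcd : 0 < κfcd) (hs : ‖R.s k ω‖ ≤ radius P R k ω)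
    (hcauchy : CauchyDecrease normH κfcd (radius P R k ω) (R.m k ω) (R.s k ω))
    {κef κeg εf : ℝ} (hκef : 0 < κef) (hκeg : 0 < κeg) (hεf : εf ≤ κef)
    {ζ ν : ℝ} (hζ : 0 < ζ)
    (hζ' : κeg + max P.η₂ (max κh (8 * κef / (κfcd * (1 - P.η₁)))) ≤ ζ)
    (hν : ν ∈ Set.Ioo (0 : ℝ) 1)
    (h₁ : (1 - ν) * (8 * P.γ ^ 2) ≤ ν * (ζ * C₁ κfcd κh κef κeg))
    (h₂ : (1 - ν) * (8 * P.γ ^ 2) ≤ ν * C₂ P.η₁ P.η₂ κfcd κh εf) :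
    let T := {ω | ζ * radius P R k ω ≤ projGrad P R f k ω}
    let I := goodModel P R f κef κeg k
    let J := goodEstimates P R f εf k
    let X := projGrad P R f k ω * radius P R k ω
    let Y := radius P R k ω ^ 2
    let b := (1 - ν) * (1 - 1 / P.γ ^ 2)
    let g := (1 - ν) * (P.γ ^ 2 - 1)
    merit P R f fmin ν (k + 1) ω - merit P R f fmin ν k ω ≤ -b * Y
      + T.indicator (fun _ => -(ν * C₁ κfcd κh κef κeg) * X + (g + b) * Y) ω
        * (I ∩ J).indicator (fun _ => 1) ω
      + T.indicator (fun _ => ν * C₃ Lg Qmax ζ * X + (g + b) * Y) ω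
        * (Iᶜ ∩ Jᶜ).indicator (fun _ => 1) ω
      + Tᶜ.indicator (fun _ => (ν * C₃ Lg Qmax ζ * ζ + g + b) * Y) ω
        * Jᶜ.indicator (fun _ => 1) ω := by
  intro T I J X Y b g
  have hδ := radius_pos P R k ω
  have hκh0 : 0 < κh := one_pos.trans_le hκh
  have hγ2 : 1 < P.γ ^ 2 := one_lt_pow₀ P.one_lt_γ two_ne_zero
  have hν' : 0 < 1 - ν := sub_pos.2 hν.2
  have hη : 0 < 1 - P.η₁ := sub_pos.2 P.η₁_lt_one
  have hY : 0 ≤ Y := sq_nonneg _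
  have hX : 0 ≤ X := mul_nonneg (norm_nonneg _) hδ.le
  have hb : 0 ≤ b := mul_nonneg hν'.le (sub_nonneg.2 ((div_le_one (by positivity)).2 hγ2.le))
  have hg : 0 ≤ g := mul_nonneg hν'.le (sub_nonneg.2 hγ2.le)
  have hc₃ : 0 ≤ C₃ Lg Qmax ζ := C₃_nonneg Lg.2 hζ
  have hmax1 : κeg + P.η₂ ≤ ζ := (add_le_add_right (le_max_left _ _) _).trans hζ'
  have hmax2 : κeg + κh ≤ ζ :=
    (add_le_add_right ((le_max_left _ _).trans (le_max_right _ _)) _).trans hζ'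
  have hmax3 : κeg + 8 * κef / (κfcd * (1 - P.η₁)) ≤ ζ :=
    (add_le_add_right ((le_max_right _ _).trans (le_max_right _ _)) _).trans hζ'
  have hmax4 : 8 * κef / κfcd ≤ 8 * κef / (κfcd * (1 - P.η₁)) :=
    div_le_div_of_nonneg_left (by positivity) (by positivity)
      (mul_le_of_le_one_right hκfcd.le (by linarith [P.η₁_pos]))
  -- the model gradient dominates the radius when the model is good and the radius is small
  have hgrad : ω ∈ T → ω ∈ I → ∀ c, κeg + c ≤ ζ → c * radius P R k ω ≤ ‖(R.m k ω).grad‖ := by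
    intro hT hI c hc
    have h1 : ζ * radius P R k ω ≤ projGrad P R f k ω := hT
    have h2 : projGrad P R f k ω ≤ _ := IsFullyLinear.le_norm_grad hI hδ
    have h3 := mul_le_mul_of_nonneg_right hc hδ.le
    linarith
  have hI_dec : ω ∈ T → ω ∈ I → C₁ κfcd κh κef κeg * X
      ≤ f (iter P R k ω) - f (iter P R k ω + act (R.Q k ω) (R.s k ω)) := by
    intro hT hI
    rw [← mul_assoc]
    exact IsFullyLinear.decrease hI hδ hκef hκeg hκfcd hκh hH hs hcauchy (hgrad hT hI _ hmax2)
      (hgrad hT hI _ (by linarith))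
  have hT_le : ω ∈ T → ζ * Y ≤ X := fun hT => by
    have := mul_le_mul_of_nonneg_right (show ζ * radius P R k ω ≤ projGrad P R f k ω from hT) hδ.le
    calc ζ * Y = ζ * radius P R k ω * radius P R k ω := by simp only [Y]; ring
      _ ≤ X := this
  have hT_lt : ω ∉ T → X ≤ ζ * Y := fun hT => by
    have := mul_le_mul_of_nonneg_right
      (not_le.1 (show ¬ ζ * radius P R k ω ≤ projGrad P R f k ω from hT)).le hδ.le
    calc X ≤ ζ * radius P R k ω * radius P R k ω := this
      _ = ζ * Y := by simp only [Y]; ring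
  have hsub : subspaceBall (iter P R k ω) P.δmax (R.Q k ω) ⊆ region P R ω :=
    Set.subset_iUnion (fun k => subspaceBall (iter P R k ω) P.δmax (R.Q k ω)) k
  have hinc : f (iter P R k ω + act (R.Q k ω) (R.s k ω)) - f (iter P R k ω)
      ≤ X + Lg * Qmax ^ 2 * Y :=
    apply_add_act_sub_le hf hLg hnormQ hQ hs (radius_le_δmax P R k ω) hsub
  have hC₃ : ζ * C₃ Lg Qmax ζ = ζ + 3 / 2 * (Lg * Qmax ^ 2) := by
    rw [C₃]; field_simp
  have hLQ : 0 ≤ (Lg : ℝ) * Qmax ^ 2 := by positivity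
  have hincT : ω ∈ T → -(C₃ Lg Qmax ζ * X)
      ≤ f (iter P R k ω) - f (iter P R k ω + act (R.Q k ω) (R.s k ω)) := by
    intro hT
    -- On T, δ² ≤ hδ/ζ, so the curvature term is absorbed into a multiple of hδ.
    have e1 : C₃ Lg Qmax ζ * X = X + 3 / 2 * (Lg * Qmax ^ 2) * (X / ζ) := by rw [C₃]; field_simp
    have e2 : Y ≤ X / ζ := (le_div_iff₀' hζ).2 (hT_le hT)
    have e3 := mul_le_mul_of_nonneg_left e2 hLQ
    have e4 : 0 ≤ Lg * Qmax ^ 2 * (X / ζ) := by positivity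
    linarith
  have hincTc : ω ∉ T → -(C₃ Lg Qmax ζ * ζ * Y)
      ≤ f (iter P R k ω) - f (iter P R k ω + act (R.Q k ω) (R.s k ω)) := by
    intro hT
    have e1 := hT_lt hT
    have e2 : C₃ Lg Qmax ζ * ζ * Y = ζ * Y + 3 / 2 * (Lg * Qmax ^ 2) * Y := by
      rw [← add_mul, ← hC₃]; ring
    have e4 : 0 ≤ Lg * Qmax ^ 2 * Y := by positivity
    linarith
  have hcX : 0 ≤ ν * (C₃ Lg Qmax ζ * X) := mul_nonneg hν.1.le (mul_nonneg hc₃ hX)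
  have hcY : 0 ≤ ν * (C₃ Lg Qmax ζ * ζ * Y) :=
    mul_nonneg hν.1.le (mul_nonneg (mul_nonneg hc₃ hζ.le) hY)
  have hgY := mul_nonneg hg hY
  have hbY := mul_nonneg hb hY
  by_cases hsucc : Success P (radius P R k ω) (R.m k ω) (R.s k ω) (R.f0 k ω) (R.fs k ω)
  · have hstep : ∀ D, _ → merit P R f fmin ν (k + 1) ω - merit P R f fmin ν k ω
        ≤ -(ν * D) + g * Y := fun D => merit_succ_sub_le_of_success fmin hν hsucc
    have hJ_step : ω ∈ J → merit P R f fmin ν (k + 1) ω - merit P R f fmin ν k ω ≤ -b * Y :=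
      fun hJ => (hstep _ (IsAccurate.decrease hJ hsucc hδ hκfcd hκh hH hcauchy)).trans
        (growth_le_shrink P.one_lt_γ hν hY h₂)
    by_cases hT : ω ∈ T
    · by_cases hI : ω ∈ I
      · have e1 := hstep _ (hI_dec hT hI)
        by_cases hJ : ω ∈ J
        · simp only [hT, hI, hJ, Set.indicator, Set.mem_inter_iff, Set.mem_compl_iff, and_self,
            not_true, if_true, if_false]
          linarith
        · simp only [hT, hI, hJ, Set.indicator, Set.mem_inter_iff, Set.mem_compl_iff, and_false,
            not_true, not_false_iff, and_true, if_true, if_false]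
          -- Good model, bad estimates: all correction terms vanish, so the decrease C₁X ≥ ζC₁Y must
          -- by itself give -bY.
          have e2 := growth_le_shrink P.one_lt_γ hν hY h₁
          have e3 := mul_le_mul_of_nonneg_left (hT_le hT)
            (mul_nonneg hν.1.le (C₁_pos (κef := κef) hκfcd hκh0 hκeg).le)
          change _ ≤ -b * Y at e2
          change _ + g * Y ≤ _ at e2
          linarith
      · by_cases hJ : ω ∈ J
        · simp only [hT, hI, hJ, Set.indicator, Set.mem_inter_iff, Set.mem_compl_iff, false_and,
            not_true, not_false_iff, and_false, if_true, if_false]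
          linarith [hJ_step hJ]
        · simp only [hT, hI, hJ, Set.indicator, Set.mem_inter_iff, Set.mem_compl_iff, and_self,
            not_true, not_false_iff, if_true, if_false]
          linarith [hstep _ (hincT hT)]
    · by_cases hJ : ω ∈ J
      · simp only [hT, hJ, Set.indicator, Set.mem_compl_iff,
          not_true, not_false_iff, if_true, if_false]
        linarith [hJ_step hJ]
      · simp only [hT, hJ, Set.indicator, Set.mem_compl_iff,
          not_false_iff, if_true, if_false]
        linarith [hstep _ (hincTc hT)]
  · have hstep : merit P R f fmin ν (k + 1) ω - merit P R f fmin ν k ω = -b * Y :=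
      merit_succ_sub_of_not_success fmin ν hsucc
    rw [hstep]
    by_cases hT : ω ∈ T
    -- An unsuccessful iteration on T cannot have both a good model and good estimates, so the only
    -- negative correction is absent.
    · have hnot : ¬ (ω ∈ I ∧ ω ∈ J) := fun h => hsucc <|
        IsFullyLinear.success h.1 h.2 hδ hεf hκfcd hκh hH hs hcauchy
          (hgrad hT h.1 _ hmax1) (hgrad hT h.1 _ hmax2) (hgrad hT h.1 _ hmax3)
      have e1 : 0 ≤ (Iᶜ ∩ Jᶜ).indicator (fun _ => (1 : ℝ)) ω :=
        Set.indicator_nonneg (fun _ _ => zero_le_one) _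
      have e2 : 0 ≤ ν * C₃ Lg Qmax ζ * X + (g + b) * Y := by linarith
      rw [Set.indicator_of_notMem (s := I ∩ J) (by exact hnot), Set.indicator_of_mem hT,
        Set.indicator_of_mem hT, Set.indicator_of_notMem (s := Tᶜ) (by simpa using hT)]
      linarith [mul_nonneg e2 e1]
    · have e1 : 0 ≤ Jᶜ.indicator (fun _ => (1 : ℝ)) ω :=
        Set.indicator_nonneg (fun _ _ => zero_le_one) _
      have e2 : 0 ≤ (ν * C₃ Lg Qmax ζ * ζ + g + b) * Y := by linarith
      rw [Set.indicator_of_notMem hT, Set.indicator_of_notMem hT,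
        Set.indicator_of_mem (s := Tᶜ) (by exact hT)]
      linarith [mul_nonneg e2 e1]

end OneStep

/-! ### Integrability and regularity of the coefficients -/

section Integrability

variable {Ω : Type*} {n p : ℕ} {P : Params n} {R : Run Ω n p} {f : E n → ℝ}

lemma measurable_projGrad_pastQ [MeasurableSpace Ω] (hR : R.IsRandom) (hf : ContDiff ℝ 1 f)
    (k : ℕ) : Measurable[pastQ R k] (projGrad P R f k) :=
  measurable_norm.comp (@Measurable.act Ω (pastQ R k) _ _ _ _
    (fun i j => measurable_entry_pastQ k j i)
    (hf.continuous_gradient.measurable.comp (measurable_iter_pastQ hR P k)))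

lemma exists_projGrad_le (hf : ContDiff ℝ 1 f) {N : Seminorm ℝ (Matrix (Fin n) (Fin p) ℝ)}
    (hN : IsConsistentNorm N) {q : ℝ} (hq : 0 ≤ q) (hQ : ∀ k ω, N (R.Q k ω) ≤ q)
    (hs : ∀ k ω, ‖R.s k ω‖ ≤ radius P R k ω) (k : ℕ) : ∃ C, ∀ ω, projGrad P R f k ω ≤ C := by
  obtain ⟨C, hC⟩ := exists_norm_comp_iter_le hf.continuous_gradient hN hq hQ hs k
  exact ⟨q * C, fun ω => (norm_act_transpose_le hN _ _).trans
    (mul_le_mul (hQ k ω) (hC ω) (norm_nonneg _) hq)⟩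

variable [MeasurableSpace Ω] {μ : Measure Ω} [IsFiniteMeasure μ]

lemma integrable_radius_sq (hR : R.IsRandom) (k : ℕ) :
    Integrable (fun ω => radius P R k ω ^ 2) μ :=
  Integrable.of_bound
    (((measurable_radius_pastQ hR P k).mono (pastQ_le hR k) le_rfl).pow_const 2).aestronglyMeasurable
    (P.δmax ^ 2) (ae_of_all _ fun ω => by
      rw [Real.norm_of_nonneg (sq_nonneg _)]
      exact pow_le_pow_left₀ (radius_pos P R k ω).le (radius_le_δmax P R k ω) 2)

lemma integrable_merit (hR : R.IsRandom) (hf : Continuous f)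
    {N : Seminorm ℝ (Matrix (Fin n) (Fin p) ℝ)}
    (hN : IsConsistentNorm N) {q : ℝ} (hq : 0 ≤ q) (hQ : ∀ k ω, N (R.Q k ω) ≤ q)
    (hs : ∀ k ω, ‖R.s k ω‖ ≤ radius P R k ω) (fmin ν : ℝ) (k : ℕ) :
    Integrable (merit P R f fmin ν k) μ := by
  obtain ⟨C, hC⟩ := exists_norm_comp_iter_le hf hN hq hQ hs k
  have h : Integrable (fun ω => f (iter P R k ω)) μ := Integrable.of_bound
    (hf.measurable.comp ((measurable_iter_pastQ hR P k).mono
      (pastQ_le hR k) le_rfl)).aestronglyMeasurable C (ae_of_all _ hC)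
  exact ((h.sub (integrable_const fmin)).const_mul ν).add
    ((integrable_radius_sq hR k).const_mul (1 - ν))

omit [MeasurableSpace Ω] in
/-- The coefficients in the pathwise bound are bounded and measurable. -/
lemma coefficient_regular {F : MeasurableSpace Ω} {h δ : Ω → ℝ} (hh : Measurable h)
    (hδ : Measurable δ) {H r : ℝ} (h0 : ∀ ω, 0 ≤ h ω) (hH : ∀ ω, h ω ≤ H) (δ0 : ∀ ω, 0 ≤ δ ω)
    (hr : ∀ ω, δ ω ≤ r) {T : Set Ω} (hT : MeasurableSet T) (c d : ℝ) :
    StronglyMeasurable (T.indicator fun ω => c * (h ω * δ ω) + d * δ ω ^ 2) ∧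
      ∃ C, ∀ ω, ‖T.indicator (fun ω => c * (h ω * δ ω) + d * δ ω ^ 2) ω‖ ≤ C := by
  refine ⟨((((hh.mul hδ).const_mul c).add
    ((hδ.pow_const 2).const_mul d)).indicator hT).stronglyMeasurable,
    |c| * (H * r) + |d| * r ^ 2, fun ω => ?_⟩
  refine (norm_indicator_le_norm_self _ _).trans ((norm_add_le _ _).trans (add_le_add ?_ ?_))
  · rw [norm_mul, Real.norm_of_nonneg (mul_nonneg (h0 ω) (δ0 ω))]
    exact mul_le_mul_of_nonneg_left
      (mul_le_mul (hH ω) (hr ω) (δ0 ω) ((h0 ω).trans (hH ω))) (norm_nonneg _)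
  · rw [norm_mul, Real.norm_of_nonneg (sq_nonneg _)]
    exact mul_le_mul_of_nonneg_left (pow_le_pow_left₀ (δ0 ω) (hr ω) 2) (norm_nonneg _)

end Integrability

end STARS

theorem mainTheorem3 {n p : ℕ} {Ω : Type*} [MeasurableSpace Ω] (μ : Measure Ω)
    [IsProbabilityMeasure μ]
    -- the objective function
    (f : STARS.E n → ℝ) (hf : ContDiff ℝ 1 f) (fmin : ℝ) (hfmin : ∀ x, fmin ≤ f x)
    -- the algorithm and the random quantities it generates
    (P : STARS.Params n) (R : STARS.Run Ω n p) (hR : R.IsRandom)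
    -- `f` and its gradient are Lipschitz on the region visited by the algorithm
    (Lf Lg : ℝ≥0) (hLf : ∀ ω, LipschitzOnWith Lf f (STARS.region P R ω))
    (hLg : ∀ ω, LipschitzOnWith Lg (gradient f) (STARS.region P R ω))
    -- matrix norms consistent with the Euclidean norm
    (normQ : Seminorm ℝ (Matrix (Fin n) (Fin p) ℝ)) (hnormQ : STARS.IsConsistentNorm normQ)
    (normH : Seminorm ℝ (Matrix (Fin p) (Fin p) ℝ)) (hnormH : STARS.IsConsistentNorm normH)
    -- bounded subspace matrices and model Hessians
    (Qmax : ℝ) (hQmax : 0 < Qmax) (hQ : ∀ k ω, normQ (R.Q k ω) ≤ Qmax)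
    (κh : ℝ) (hκh : 1 ≤ κh) (hH : ∀ k ω, normH (R.m k ω).hess ≤ κh)
    -- trial steps: in the trust region, with a fraction of the Cauchy decrease
    (κfcd : ℝ) (hκfcd : 0 < κfcd) (hκfcd' : κfcd ≤ 1)
    (hs : ∀ k ω, ‖R.s k ω‖ ≤ STARS.radius P R k ω)
    (hcauchy : ∀ k ω,
      STARS.CauchyDecrease normH κfcd (STARS.radius P R k ω) (R.m k ω) (R.s k ω))
    -- probabilistic accuracy of the models and of the estimates
    (κef κeg εf βm βf : ℝ) (hκef : 0 < κef) (hκeg : 0 < κeg) (hεf : 0 < εf)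
    (hεf' : εf < min κef (1 / 4 * P.η₁ * P.η₂ * κfcd * min (P.η₂ / κh) 1))
    (hβm : βm ∈ Set.Ioo (0 : ℝ) 1) (hβf : βf ∈ Set.Ioo (0 : ℝ) 1)
    (hmodel : STARS.ProbFullyLinear μ P R f κef κeg βm)
    (hestim : STARS.ProbAccurate μ P R f εf βf)
    -- choice of `ζ`, `ν`, `β_f` and `β_m`
    (ζ ν : ℝ) (hζ : 0 < ζ)
    (hζ' : κeg + max P.η₂ (max κh (8 * κef / (κfcd * (1 - P.η₁)))) ≤ ζ)
    (hν : ν ∈ Set.Ioo (0 : ℝ) 1)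
    (hν' : 8 * P.γ ^ 2 / min (STARS.C₂ P.η₁ P.η₂ κfcd κh εf) (ζ * STARS.C₁ κfcd κh κef κeg)
      ≤ ν / (1 - ν))
    (hβ : STARS.C₃ Lg Qmax ζ / STARS.C₁ κfcd κh κef κeg
      ≤ (βf * βm - 1 / 2) / ((1 - βf) + (1 - βm)))
    (hβ' : 2 * ν * ζ * P.γ ^ 2 * STARS.C₃ Lg Qmax ζ / ((1 - ν) * (P.γ ^ 2 - 1)) + 2 * P.γ ^ 2
      ≤ βf / (1 - βf))
    (ϱ : ℝ) (hϱ : ϱ = 1 / 2 * βf * (1 - ν) * (1 - 1 / P.γ ^ 2)) :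
    0 < ϱ ∧
    (∀ k, Integrable (STARS.merit P R f fmin ν k) μ ∧
      ∀ᵐ ω ∂μ,
        (μ[STARS.merit P R f fmin ν (k + 1) - STARS.merit P R f fmin ν k | STARS.pastQ R k]) ω
          ≤ -ϱ * STARS.radius P R k ω ^ 2) ∧
    (∀ᵐ ω ∂μ, Summable (fun k => STARS.radius P R k ω ^ 2)) ∧
    (∀ᵐ ω ∂μ, Tendsto (fun k => STARS.radius P R k ω) atTop (𝓝 0)) := by
  have hγ := P.one_lt_γ
  have hγ2 : 1 < P.γ ^ 2 := one_lt_pow₀ hγ two_ne_zero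
  have hν1 : 0 < 1 - ν := sub_pos.2 hν.2
  have hκh0 : 0 < κh := one_pos.trans_le hκh
  have hu : 0 < 1 - 1 / P.γ ^ 2 := sub_pos.2 ((div_lt_one (by positivity)).2 hγ2)
  have hϱ0 : 0 < ϱ := by
    rw [hϱ]
    exact mul_pos (mul_pos (mul_pos (by norm_num) hβf.1) hν1) hu
  have hC₁ : 0 < STARS.C₁ κfcd κh κef κeg := STARS.C₁_pos hκfcd hκh0 hκeg
  have hC₂ : 0 < STARS.C₂ P.η₁ P.η₂ κfcd κh εf := STARS.C₂_pos (hεf'.trans_le (min_le_right _ _))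
  have hC₃ : 0 ≤ STARS.C₃ Lg Qmax ζ := STARS.C₃_nonneg Lg.2 hζ
  have hmin : (1 - ν) * (8 * P.γ ^ 2)
      ≤ ν * min (STARS.C₂ P.η₁ P.η₂ κfcd κh εf) (ζ * STARS.C₁ κfcd κh κef κeg) := by
    rw [div_le_div_iff₀ (lt_min hC₂ (mul_pos hζ hC₁)) hν1] at hν'
    linarith
  have h₁ := hmin.trans (mul_le_mul_of_nonneg_left (min_le_right _ _) hν.1.le)
  have h₂ := hmin.trans (mul_le_mul_of_nonneg_left (min_le_left _ _) hν.1.le)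
  have hint := STARS.integrable_merit (μ := μ) hR hf.continuous hnormQ hQmax.le hQ hs fmin ν
  have hdesc : ∀ k, ∀ᵐ ω ∂μ,
      (μ[STARS.merit P R f fmin ν (k + 1) - STARS.merit P R f fmin ν k | STARS.pastQ R k]) ω
        ≤ -ϱ * STARS.radius P R k ω ^ 2 := by
    intro k
    have hF := STARS.pastQ_le hR k
    have hG := STARS.pastMQ_le hR k
    have hI := STARS.measurableSet_goodModel hR P hf κef κeg k
    have hJ := STARS.measurableSet_goodEstimates hR P hf.continuous εf k
    have hδm := STARS.measurable_radius_pastQ hR P k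
    have hhm := STARS.measurable_projGrad_pastQ (P := P) hR hf k
    obtain ⟨H, hH'⟩ := STARS.exists_projGrad_le hf hnormQ hQmax.le hQ hs k
    have hT : MeasurableSet[STARS.pastQ R k]
        {ω | ζ * STARS.radius P R k ω ≤ STARS.projGrad P R f k ω} :=
      measurableSet_le (hδm.const_mul ζ) hhm
    have hreg := fun {T : Set Ω} (hT : MeasurableSet[STARS.pastQ R k] T) (c d : ℝ) =>
      STARS.coefficient_regular hhm hδm (fun ω => norm_nonneg _) hH'
        (fun ω => (STARS.radius_pos P R k ω).le) (STARS.radius_le_δmax P R k) hT c d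
    -- The baseline coefficient is the degenerate case of the whole space and no hδ term.
    have hb := hreg MeasurableSet.univ 0 (-((1 - ν) * (1 - 1 / P.γ ^ 2)))
    have he := hreg hT.compl 0 (ν * STARS.C₃ Lg Qmax ζ * ζ + (1 - ν) * (P.γ ^ 2 - 1)
      + (1 - ν) * (1 - 1 / P.γ ^ 2))
    simp only [zero_mul, zero_add, Set.indicator_univ] at hb he
    have key := STARS.condExp_le_of_le_indicators (μ := μ) hF ((hG _ hI).inter hJ)
      ((hG _ hI).compl.inter hJ.compl) hJ.compl ((hint (k + 1)).sub (hint k)) hb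
      (hreg hT (-(ν * STARS.C₁ κfcd κh κef κeg))
        ((1 - ν) * (P.γ ^ 2 - 1) + (1 - ν) * (1 - 1 / P.γ ^ 2)))
      (hreg hT (ν * STARS.C₃ Lg Qmax ζ)
        ((1 - ν) * (P.γ ^ 2 - 1) + (1 - ν) * (1 - 1 / P.γ ^ 2))) he
      (fun ω => by
        have h := STARS.merit_succ_sub_le hf fmin (hLg ω) hnormQ (hQ k ω) hκh (hH k ω) hκfcd
          (hs k ω) (hcauchy k ω) hκef hκeg (hεf'.le.trans (min_le_left _ _)) hζ hζ' hν h₁ h₂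
        simp only [Set.indicator, Pi.sub_apply] at h ⊢
        exact h)
    filter_upwards [key, STARS.condProb_bounds (STARS.pastQ_le_pastMQ R k) hG hI hJ hβf.1.le
      hβf.2.le (hmodel k) (hestim k)] with ω hω hprob
    refine hω.trans ?_
    have hδ := (STARS.radius_pos P R k ω).le
    rw [hϱ]
    -- T belongs to the conditioning σ-algebra, so its indicators sit in the coefficients and the
    -- two regimes can be separated after conditioning.
    by_cases hωT : ω ∈ {ω | ζ * STARS.radius P R k ω ≤ STARS.projGrad P R f k ω}
    · rw [Set.indicator_of_mem hωT, Set.indicator_of_mem hωT,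
        Set.indicator_of_notMem (not_not_intro hωT), zero_mul, add_zero]
      refine STARS.expected_bound_of_small_radius hγ hν hC₁ hC₃ hβf hβm ?_
        (mul_nonneg (norm_nonneg _) hδ) (sq_nonneg _) h₁ hβ hprob.1 hprob.2.1
      have := mul_le_mul_of_nonneg_right (show ζ * _ ≤ _ from hωT) hδ
      linarith
    · rw [Set.indicator_of_notMem hωT, Set.indicator_of_notMem hωT,
        Set.indicator_of_mem (Set.mem_compl hωT), zero_mul, add_zero, zero_mul, add_zero]
      exact STARS.expected_bound_of_large_radius hγ hν hC₃ hζ hβf (sq_nonneg _) hβ' hprob.2.2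
  have hsum : ∀ᵐ ω ∂μ, Summable fun k => STARS.radius P R k ω ^ 2 := by
    refine STARS.ae_summable_of_integral_descent (φ := STARS.merit P R f fmin ν)
      (fun _ _ => STARS.merit_nonneg hfmin hν) (fun _ _ => sq_nonneg _)
      (STARS.integrable_radius_sq hR) hϱ0 fun k => ?_
    -- Integrating the conditional inequality removes the conditioning and yields the descent of
    -- expectations.
    have h := integral_mono_ae integrable_condExp
      ((STARS.integrable_radius_sq (μ := μ) hR k).const_mul (-ϱ)) (hdesc k)
    rw [integral_condExp (STARS.pastQ_le hR k), integral_const_mul,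
      integral_sub' (hint (k + 1)) (hint k)] at h
    linarith
  refine ⟨hϱ0, fun k => ⟨hint k, hdesc k⟩, hsum, ?_⟩
  filter_upwards [hsum] with ω hω
  have h := hω.tendsto_atTop_zero.sqrt
  simpa only [Real.sqrt_sq (STARS.radius_pos P R _ ω).le, Real.sqrt_zero] using h
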